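/- Fix integers $d,r\ge 1$, a set $\mathcal S\subset\mathbb R^2$, loading functions $a=(a_1,\dots,a_d)':\mathcal S\to\mathbb R^d$ and a centered $d\times r$ matrix-valued process $X=(X_t)_{t\in\mathbb Z}$. For $N\in\mathbb N$ let $p=p_N$, $T=T_N$ be integers, $B$ a $p\times r$ matrix, and $\mathcal S_1,\mathcal S_2\subset\mathcal S$ disjoint finite sets of $n_1,n_2\ge d$ sites; put $n=n_1+n_2$ and let $n,p,T\to\infty$ as $N\to\infty$. For $t=1,\dots,T$ and $s\in\mathcal S_1\cup\mathcal S_2$ one observes $$y_t(s)=BX_t'a(s)+\varepsilon_t(s)\in\mathbb R^p ,$$ equivalently $Y_{lt}=A_lX_tB'+E_{lt}$, $l=1,2$, where $Y_{lt}$, $A_l$, $E_{lt}$ have the rows $y_t(s)'$, $a(s)'$, $\varepsilon_t(s)'$, $s\in\mathcal S_l$. Noise: $\varepsilon_t(s)$ is square integrable with mean zero; $\mathrm{Cov}(\varepsilon_t(u),\varepsilon_t(v))=0$ for $u\neq v$; the fields $\varepsilon_t$, $t\in\mathbb Z$, are independent of each other and of $X$; and there is a constant $K$, not depending on $N$, $t$,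 the sites or the coordinates, with $E\,\varepsilon_{t,i}(u)^2\le K$ for all sampled $u$, and $E[\varepsilon_{t,i}(u)^2\varepsilon_{t,j}(v)^2]\le K$ for $u\in\mathcal S_1$, $v\in\mathcal S_2$. Let $\Omega_{ij}=\mathrm{Cov}(Y_{1t,\cdot i},Y_{2t,\cdot j})$, $M_{1}=\sum_{i,j=1}^p\Omega_{ij}\Omega_{ij}'$, $M_{2}=\sum_{i,j=1}^p\Omega_{ij}'\Omega_{ij}$ (these do not depend on $t$). Identification: for all large $N$, $M_1$ and $M_2$ have rank $d$, i.e. $d$ positive eigenvalues. Write $\|A\|_2^2=\lambda_{\max}(A'A)$, let $\|A\|_{\min}^2$ be the smallest eigenvalue of $A'A$ or $AA'$, whichever is the smaller matrix, and $a_N\asymp b_N$ if $a_N=O(b_N)$ and $b_N=O(a_N)$. Assume: 1. $(X_t)$ is strictly stationary and $\alpha$-mixing, with $\sum_{h\ge1}\alpha(h)^{1-2/q}<\infty$ for some $q>2$, where $\alpha(h)=\sup_\tau\sup|P(F\cap G)-P(F)P(G)|$, the inner supremum being over $F\in\sigma(X_t:t\le\tau)$, $G\in\sigma(X_t:t\ge\tau+h)$.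 2. $E|X_{t,ij}|^{2q}\le C$ for all $t,i,j$. Moreover there is a lag $h\ge1$ such that the $\max(d,r)$-th largest singular value of $\Sigma_f(h)=\mathrm{Cov}(\mathrm{vec}\,X_t,\mathrm{vec}\,X_{t+h})$ is positive (equivalently, $\mathrm{rank}\,\Sigma_f(h)\ge\max(d,r)$), and $\mathrm{Cov}(X_{t,i\cdot},X_{t+h,i\cdot})\ne0$, $\mathrm{Cov}(X_{t,\cdot j},X_{t+h,\cdot j})\neq0$ for every row $i$ and every column $j$. 3. For a constant $\delta\in[0,1]$: $\|A_l\|_{\min}^2\asymp n_l^{1-\delta}\asymp\|A_l\|_2^2$, $l=1,2$. 4. For a constant $\gamma\in[0,1]$: $\|B\|_{\min}^2\asymp p^{1-\gamma}\asymp\|B\|_2^2$. Let $\hat\Omega_{ij}=T^{-1}\sum_{t=1}^TY_{1t,\cdot i}Y_{2t,\cdot j}'$, $\hat M_1=\sum_{i,j}\hat\Omega_{ij}\hat\Omega_{ij}'$, $\hat M_2=\sum_{i,j}\hat\Omega_{ij}'\hat\Omega_{ij}$, and let $\hat A_l$ be any $n_l\times d$ matrix with orthonormal columns whose $j$-th column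 is an eigenvector of $\hat M_l$ for its $j$-th largest eigenvalue. For $n_l\times d$ matrices $U,V$ of rank $d$ let $$\mathcal D(\mathcal M(U),\mathcal M(V))=\Bigl(1-\tfrac1d\,\mathrm{tr}\bigl(U(U'U)^{-1}U'\,V(V'V)^{-1}V'\bigr)\Bigr)^{1/2}$$ be the distance of their column spaces. If $n^\delta p^\gamma T^{-1/2}=o(1)$, then for $l=1,2$ $$\mathcal D(\mathcal M(\hat A_l),\mathcal M(A_l))=O_p\Bigl(\bigl((n_1n_2^{\delta-1}p^\gamma+n_1^{\delta-1}n_2p^\gamma+n_1^\delta n_2^\delta p^{2\gamma})T^{-1}\bigr)^{1/2}\Bigr).$$ If in addition $n_1\asymp n_2\asymp n$, then for $l=1,2$ $$\mathcal D(\mathcal M(\hat A_l),\mathcal M(A_l))=O_p\bigl(n^\delta p^\gamma T^{-1/2}\bigr).$$ -/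

import Mathlib

open MeasureTheory ProbabilityTheory Filter Asymptotics
open scoped Matrix Topology

noncomputable section

namespace SpatialFactor

/-! ### Matrix notions -/

/-- The real eigenvalues of a square matrix. -/
def eigenvalueSet {ι : Type*} [Fintype ι] (M : Matrix ι ι ℝ) : Set ℝ :=
  {c | ∃ v : ι → ℝ, v ≠ 0 ∧ M *ᵥ v = c • v}

/-- `‖A‖₂² = λ_max(A'A)`, the squared spectral norm. -/
def specNormSq {m n : Type*} [Fintype m] [Fintype n] (A : Matrix m n ℝ) : ℝ :=
  sSup (eigenvalueSet (Aᵀ * A))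

/-- `‖A‖_min²`, the smallest eigenvalue of `A'A` or of `AA'`, whichever matrix is smaller. -/
def minNormSq {m n : Type*} [Fintype m] [Fintype n] (A : Matrix m n ℝ) : ℝ :=
  if Fintype.card n ≤ Fintype.card m then sInf (eigenvalueSet (Aᵀ * A))
  else sInf (eigenvalueSet (A * Aᵀ))

/-- The distance `D(M(U), M(V))` between the column spaces of two matrices of full column rank,
`(1 - tr(U (U'U)⁻¹ U' V (V'V)⁻¹ V') / max(k, l))^{1/2}`. -/
def spaceDist {ι : Type*} [Fintype ι] {k l : ℕ}
    (U : Matrix ι (Fin k) ℝ) (V : Matrix ι (Fin l) ℝ) : ℝ :=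
  Real.sqrt (1 - ((U * (Uᵀ * U)⁻¹ * Uᵀ) * (V * (Vᵀ * V)⁻¹ * Vᵀ)).trace / (max k l : ℕ))

open Classical in
/-- The columns of `U` are orthonormal, and the `j`-th one is an eigenvector of the symmetric
matrix `M` for its `j`-th largest eigenvalue, counted with multiplicity
(`Matrix.IsHermitian.eigenvalues₀` lists the eigenvalues in decreasing order). -/
def IsLeadingEigenvectors {ι : Type*} [Fintype ι] {d : ℕ}
    (M : Matrix ι ι ℝ) (U : Matrix ι (Fin d) ℝ) : Prop :=
  Uᵀ * U = 1 ∧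
    ∃ (hM : M.IsHermitian) (hd : d ≤ Fintype.card ι),
      ∀ j : Fin d, M *ᵥ (fun i => U i j) = hM.eigenvalues₀ (Fin.castLE hd j) • fun i => U i j

/-! ### Stochastic notions -/

/-- `R N = O_p(ρ N)` as `N → ∞`. -/
def IsBigOp {Ω : Type*} [MeasurableSpace Ω] (μ : Measure Ω) (R : ℕ → Ω → ℝ) (ρ : ℕ → ℝ) : Prop :=
  ∀ η : ℝ, 0 < η → ∃ K : ℝ, 0 < K ∧
    ∀ᶠ N in atTop, μ {ω | K * ρ N < |R N ω|} ≤ ENNReal.ofReal η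

section MixingNotions

variable {Ω : Type*} [MeasurableSpace Ω] {d r : ℕ}

/-- The σ-field generated by `vec(X_t)`, `t ∈ I`. -/
abbrev sigmaField (X : ℤ → Ω → Matrix (Fin d) (Fin r) ℝ) (I : Set ℤ) : MeasurableSpace Ω :=
  ⨆ t ∈ I, MeasurableSpace.comap (fun ω (k : Fin d × Fin r) => X t ω k.1 k.2) inferInstance

/-- The α-mixing coefficient at lag `h`. -/
def alphaMixing (μ : Measure Ω) (X : ℤ → Ω → Matrix (Fin d) (Fin r) ℝ) (h : ℕ) : ℝ :=
  sSup {x | ∃ (τ : ℤ) (A B : Set Ω), MeasurableSet[sigmaField X (Set.Iic τ)] A ∧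
    MeasurableSet[sigmaField X (Set.Ici (τ + h))] B ∧
    x = |μ.real (A ∩ B) - μ.real A * μ.real B|}

/-- Strict stationarity: the law of the whole process is invariant under time shifts. -/
def StrictlyStationary (μ : Measure Ω) (X : ℤ → Ω → Matrix (Fin d) (Fin r) ℝ) : Prop :=
  ∀ s : ℤ, μ.map (fun ω (t : ℤ) (k : Fin d × Fin r) => X (t + s) ω k.1 k.2) =
    μ.map (fun ω (t : ℤ) (k : Fin d × Fin r) => X t ω k.1 k.2)

/-- `Σ_f(h) = Cov(vec(X_t), vec(X_{t+h}))`, which does not depend on `t` for a stationary `X`. -/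
def lagCov (μ : Measure Ω) (X : ℤ → Ω → Matrix (Fin d) (Fin r) ℝ) (h : ℕ) :
    Matrix (Fin d × Fin r) (Fin d × Fin r) ℝ :=
  Matrix.of fun k l => cov[fun ω => X 0 ω k.1 k.2, fun ω => X h ω l.1 l.2; μ]

end MixingNotions

/-! ### The model -/

/-- The data of the asymptotic setting, indexed by `N`: at stage `N` one observes a
`p N`-dimensional spatio-temporal process at the sites in `S₁ N ∪ S₂ N` and at times
`1, …, T N`. The latent `d × r` factor process `X` and the loading functions `a` are fixed. -/
structure Model (Ω : Type*) (d r : ℕ) (𝒮 : Set (EuclideanSpace ℝ (Fin 2))) where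
  /-- latent matrix factor process -/
  X : ℤ → Ω → Matrix (Fin d) (Fin r) ℝ
  /-- spatial loading functions, `a s = (a_1(s), …, a_d(s))` -/
  a : 𝒮 → Fin d → ℝ
  /-- number of variables -/
  p : ℕ → ℕ
  /-- number of time points -/
  T : ℕ → ℕ
  /-- first set of the partition of the sampling sites -/
  S₁ : ℕ → Finset 𝒮
  /-- second set of the partition of the sampling sites -/
  S₂ : ℕ → Finset 𝒮
  /-- variable loading matrix -/
  B : (N : ℕ) → Matrix (Fin (p N)) (Fin r) ℝ
  /-- additive error (nugget) process -/
  ε : (N : ℕ) → ℤ → Ω → 𝒮 → Fin (p N) → ℝ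

namespace Model

variable {Ω : Type*} {d r : ℕ} {𝒮 : Set (EuclideanSpace ℝ (Fin 2))} (m : Model Ω d r 𝒮)

/-- `n₁` -/
def n₁ (N : ℕ) : ℕ := (m.S₁ N).card

/-- `n₂` -/
def n₂ (N : ℕ) : ℕ := (m.S₂ N).card

/-- `n = n₁ + n₂` -/
def n (N : ℕ) : ℕ := m.n₁ N + m.n₂ N

/-- The observed process `y_t(s) = B X_t' a(s) + ε_t(s)`. -/
def y (N : ℕ) (t : ℤ) (ω : Ω) (s : 𝒮) : Fin (m.p N) → ℝ :=
  (m.B N * (m.X t ω)ᵀ) *ᵥ m.a s + m.ε N t ω s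

/-- `A₁`, with rows `a(s)'`, `s ∈ S₁`. -/
def A₁ (N : ℕ) : Matrix (m.S₁ N) (Fin d) ℝ := Matrix.of fun s => m.a s

/-- `A₂`, with rows `a(s)'`, `s ∈ S₂`. -/
def A₂ (N : ℕ) : Matrix (m.S₂ N) (Fin d) ℝ := Matrix.of fun s => m.a s

/-- Sample cross-space covariance `Ω̂_{A,ij} = T⁻¹ ∑_{t=1}^T Y_{1t,·i} Y_{2t,·j}'`. -/
def sampleOmega (N : ℕ) (ω : Ω) (i j : Fin (m.p N)) : Matrix (m.S₁ N) (m.S₂ N) ℝ :=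
  (m.T N : ℝ)⁻¹ • ∑ t ∈ Finset.Icc 1 (m.T N),
    Matrix.vecMulVec (fun u : m.S₁ N => m.y N t ω u i) (fun v : m.S₂ N => m.y N t ω v j)

/-- `M̂_{A₁}` -/
def sampleM₁ (N : ℕ) (ω : Ω) : Matrix (m.S₁ N) (m.S₁ N) ℝ :=
  ∑ i, ∑ j, m.sampleOmega N ω i j * (m.sampleOmega N ω i j)ᵀ

/-- `M̂_{A₂}` -/
def sampleM₂ (N : ℕ) (ω : Ω) : Matrix (m.S₂ N) (m.S₂ N) ℝ :=
  ∑ i, ∑ j, (m.sampleOmega N ω i j)ᵀ * m.sampleOmega N ω i j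

variable [MeasurableSpace Ω] (μ : Measure Ω)

/-- Cross-space covariance `Ω_{A,ij} = Cov(Y_{1t,·i}, Y_{2t,·j})`. It does not depend on `t`
under the assumptions below, and is taken at `t = 0`. -/
def popOmega (N : ℕ) (i j : Fin (m.p N)) : Matrix (m.S₁ N) (m.S₂ N) ℝ :=
  Matrix.of fun u v => cov[fun ω => m.y N 0 ω u i, fun ω => m.y N 0 ω v j; μ]

/-- `M_{A₁}` -/
def popM₁ (N : ℕ) : Matrix (m.S₁ N) (m.S₁ N) ℝ :=
  ∑ i, ∑ j, m.popOmega μ N i j * (m.popOmega μ N i j)ᵀ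

/-- `M_{A₂}` -/
def popM₂ (N : ℕ) : Matrix (m.S₂ N) (m.S₂ N) ℝ :=
  ∑ i, ∑ j, (m.popOmega μ N i j)ᵀ * m.popOmega μ N i j

/-- Sampling design: two disjoint sets of at least `d` sites each; `n`, `p`, `T` tend to
infinity while `d` and `r` stay fixed. -/
structure Design : Prop where
  disjoint : ∀ N, Disjoint (m.S₁ N) (m.S₂ N)
  d_le_n₁ : ∀ N, d ≤ m.n₁ N
  d_le_n₂ : ∀ N, d ≤ m.n₂ N
  n_tendsto : Tendsto m.n atTop atTop
  p_tendsto : Tendsto m.p atTop atTop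
  T_tendsto : Tendsto m.T atTop atTop

/-- The nugget process is centered white noise with bounded variances, uncorrelated over space;
the fields `ε_t`, `t ∈ ℤ`, are independent of each other and of the factor process. The mixed
moment bound follows from the variance bound if the nugget is independent over space, and holds
as well if fourth moments are bounded. -/
structure NuggetNoise : Prop where
  measurable : ∀ N t s i, Measurable fun ω => m.ε N t ω s i
  memLp : ∀ N t s i, MemLp (fun ω => m.ε N t ω s i) 2 μ
  mean_zero : ∀ N t s i, ∫ ω, m.ε N t ω s i ∂μ = 0
  uncorrelated : ∀ N t (u v : 𝒮), u ≠ v → ∀ i j,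
    cov[fun ω => m.ε N t ω u i, fun ω => m.ε N t ω v j; μ] = 0
  indep_time : ∀ N,
    iIndepFun (fun (t : ℤ) ω (k : 𝒮 × Fin (m.p N)) => m.ε N t ω k.1 k.2) μ
  indep_factor : ∀ N,
    IndepFun (fun ω (t : ℤ) (k : Fin d × Fin r) => m.X t ω k.1 k.2)
      (fun ω (t : ℤ) (k : 𝒮 × Fin (m.p N)) => m.ε N t ω k.1 k.2) μ
  bounded : ∃ K : ℝ,
    (∀ N t, ∀ u ∈ (m.S₁ N : Set 𝒮) ∪ m.S₂ N, ∀ i, ∫ ω, (m.ε N t ω u i) ^ 2 ∂μ ≤ K) ∧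
    (∀ N t, ∀ u ∈ m.S₁ N, ∀ v ∈ m.S₂ N, ∀ i j,
      Integrable (fun ω => (m.ε N t ω u i) ^ 2 * (m.ε N t ω v j) ^ 2) μ ∧
        ∫ ω, (m.ε N t ω u i) ^ 2 * (m.ε N t ω v j) ^ 2 ∂μ ≤ K)

/-- Identification: `M_{A₁}` and `M_{A₂}` have `d` positive eigenvalues. -/
def Identified : Prop :=
  ∀ᶠ N in atTop, (m.popM₁ μ N).rank = d ∧ (m.popM₂ μ N).rank = d

/-- The latent factor is centered, strictly stationary and α-mixing with
`∑_{h ≥ 1} α(h)^{1 - 2/q} < ∞`, where `q > 2`. -/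
structure MixingCondition (q : ℝ) : Prop where
  measurable : ∀ t i j, Measurable fun ω => m.X t ω i j
  mean_zero : ∀ t i j, ∫ ω, m.X t ω i j ∂μ = 0
  stationary : StrictlyStationary μ m.X
  two_lt : 2 < q
  mixing : Summable fun h : ℕ => alphaMixing μ m.X (h + 1) ^ (1 - 2 / q)

/-- Bounded moments of order `2q` of the factor, and for some lag `h ≥ 1` a lagged covariance
`Σ_f(h)` whose `max(d, r)`-th singular value is positive, with nonzero lagged autocovariance of
each row and each column of the factor. -/
structure MomentRankCondition (q : ℝ) : Prop where
  moments : ∃ C : ℝ, 0 < C ∧ ∀ t i j, Integrable (fun ω => |m.X t ω i j| ^ (2 * q)) μ ∧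
    ∫ ω, |m.X t ω i j| ^ (2 * q) ∂μ ≤ C
  lagged : ∃ h : ℕ, 1 ≤ h ∧ max d r ≤ (lagCov μ m.X h).rank ∧
    (∀ i : Fin d, ∃ j l : Fin r, cov[fun ω => m.X 0 ω i j, fun ω => m.X h ω i l; μ] ≠ 0) ∧
    (∀ j : Fin r, ∃ i k : Fin d, cov[fun ω => m.X 0 ω i j, fun ω => m.X h ω k j; μ] ≠ 0)

/-- Spatial factor strength `δ ∈ [0, 1]`. -/
structure SpatialStrength (δ : ℝ) : Prop where
  mem : δ ∈ Set.Icc (0 : ℝ) 1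
  min₁ : (fun N => minNormSq (m.A₁ N)) =Θ[atTop] fun N => (m.n₁ N : ℝ) ^ (1 - δ)
  max₁ : (fun N => specNormSq (m.A₁ N)) =Θ[atTop] fun N => (m.n₁ N : ℝ) ^ (1 - δ)
  min₂ : (fun N => minNormSq (m.A₂ N)) =Θ[atTop] fun N => (m.n₂ N : ℝ) ^ (1 - δ)
  max₂ : (fun N => specNormSq (m.A₂ N)) =Θ[atTop] fun N => (m.n₂ N : ℝ) ^ (1 - δ)

/-- Variable factor strength `γ ∈ [0, 1]`. -/
structure VariableStrength (γ : ℝ) : Prop where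
  mem : γ ∈ Set.Icc (0 : ℝ) 1
  min : (fun N => minNormSq (m.B N)) =Θ[atTop] fun N => (m.p N : ℝ) ^ (1 - γ)
  max : (fun N => specNormSq (m.B N)) =Θ[atTop] fun N => (m.p N : ℝ) ^ (1 - γ)

/-- The rate
`((n₁ n₂^{δ-1} p^γ + n₁^{δ-1} n₂ p^γ + n₁^δ n₂^δ p^{2γ}) T⁻¹)^{1/2}`. -/
def rate (δ γ : ℝ) (N : ℕ) : ℝ :=
  Real.sqrt
    (((m.n₁ N : ℝ) * (m.n₂ N : ℝ) ^ (δ - 1) * (m.p N : ℝ) ^ γ +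
      (m.n₁ N : ℝ) ^ (δ - 1) * (m.n₂ N : ℝ) * (m.p N : ℝ) ^ γ +
      (m.n₁ N : ℝ) ^ δ * (m.n₂ N : ℝ) ^ δ * (m.p N : ℝ) ^ (2 * γ)) * (m.T N : ℝ)⁻¹)

/-- The rate `n^δ p^γ T^{-1/2}`. -/
def balancedRate (δ γ : ℝ) (N : ℕ) : ℝ :=
  (m.n N : ℝ) ^ δ * (m.p N : ℝ) ^ γ * (m.T N : ℝ) ^ (-(1 / 2) : ℝ)

end Model

end SpatialFactor

end

noncomputable section

namespace SpatialFactor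

/-! ### Quadratic forms and eigenvalues -/

section LinearAlgebra

variable {ι κ : Type*} [Fintype ι] [Fintype κ]

/-! Placing the blocks `Ω_ij` side by side gives `M₁ = W W'`, with `W` the `n₁ × n₂p²` unfolding of
the cross-space covariance of all variables; in the same way `M̂₁ = Ŵ Ŵ'`. The estimated loadings
are therefore leading left singular vectors of `Ŵ`. Because the two sets of sites are disjoint, the
noise drops out of the population covariance, which is `(A₁ ⊗ B) Σ (A₂ ⊗ B)'` with `Σ = E[vec X vec
X']` (`popOmega_apply`). Its unfolding has the form `W = A₁ G`, so the columns of `W` lie in the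
column space of `A₁`.

The proof compares a signal strength with a mean square error. If `‖W'v‖² ≥ s‖v‖²` on the column
space of `A₁`, then `s D² ≤ 4‖Ŵ - W‖_F²` for every sample (`mul_spaceDist_sq_le`).

Signal: `signal_lower_bound` gives `s` of order `n₁^{1-δ} n₂^{1-δ} p^{2-2γ}`, one power for each
loading matrix, times a constant from the unfolding of `Σ`. That constant is positive by
identification at a single stage, since `Σ` does not depend on `N`.

Error: `Ŵ - W` splits into factor-factor, factor-noise, noise-factor and noise-noise averages.
Independence over time makes the summands of the last three orthogonal. The first is controlled by
Davydov's inequality (`abs_covariance_le_rpow`) and summability of `α(h)^{1-2/q}`. In total `E‖Ŵ -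
W‖_F² = O(n₁n₂p²/T)` (`exists_cross_error_bound`).

The quotient is `n₁^δ n₂^δ p^{2γ}/T`, which is a summand of the squared rate and is at most the
squared balanced rate. Markov's inequality turns the mean square bound into `O_p`, and exchanging
the two sets of sites gives the case `l = 2`. -/

theorem dotProduct_self_nonneg (v : ι → ℝ) : 0 ≤ v ⬝ᵥ v :=
  Finset.sum_nonneg fun i _ => mul_self_nonneg (v i)

theorem dotProduct_sq_le (v w : ι → ℝ) : (v ⬝ᵥ w) ^ 2 ≤ (v ⬝ᵥ v) * (w ⬝ᵥ w) := by
  have := Finset.sum_mul_sq_le_sq_mul_sq Finset.univ v w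
  simpa [dotProduct, sq] using this

/-- The squared Frobenius norm. -/
def frobSq (A : Matrix ι κ ℝ) : ℝ := ∑ i, ∑ j, A i j ^ 2

theorem frobSq_nonneg (A : Matrix ι κ ℝ) : 0 ≤ frobSq A :=
  Finset.sum_nonneg fun _ _ => Finset.sum_nonneg fun _ _ => sq_nonneg _

theorem frobSq_transpose (A : Matrix ι κ ℝ) : frobSq Aᵀ = frobSq A :=
  Finset.sum_comm

theorem frobSq_eq_trace (A : Matrix ι κ ℝ) : frobSq A = (Aᵀ * A).trace := by
  rw [← frobSq_transpose]
  simp [frobSq, Matrix.trace, Matrix.mul_apply, sq]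

theorem mulVec_dotProduct_self_le (A : Matrix ι κ ℝ) (v : κ → ℝ) :
    (A *ᵥ v) ⬝ᵥ (A *ᵥ v) ≤ frobSq A * (v ⬝ᵥ v) := by
  rw [frobSq, Finset.sum_mul]
  refine Finset.sum_le_sum fun i _ => ?_
  have := dotProduct_sq_le (A i) v
  calc (A *ᵥ v) i * (A *ᵥ v) i = (A i ⬝ᵥ v) ^ 2 := by rw [sq]; rfl
    _ ≤ _ := this
    _ = _ := by simp [dotProduct, sq]

theorem frobSq_mul_le {η : Type*} [Fintype η] (A : Matrix ι κ ℝ) (B : Matrix κ η ℝ) :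
    frobSq (A * B) ≤ frobSq A * frobSq B := by
  rw [frobSq, frobSq, Finset.sum_mul]
  refine Finset.sum_le_sum fun i _ => ?_
  rw [← frobSq_transpose B, frobSq, Finset.mul_sum]
  refine Finset.sum_le_sum fun j _ => ?_
  have := dotProduct_sq_le (A i) (Bᵀ j)
  rw [Matrix.mul_apply]
  simpa [dotProduct, sq] using this

theorem isHermitian_transpose_mul {η : Type*} (A : Matrix ι η ℝ) : (Aᵀ * A).IsHermitian := by
  simpa using Matrix.isHermitian_conjTranspose_mul_self A

theorem dotProduct_transpose_mul_mulVec (A : Matrix ι κ ℝ) (v : κ → ℝ) :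
    v ⬝ᵥ ((Aᵀ * A) *ᵥ v) = (A *ᵥ v) ⬝ᵥ (A *ᵥ v) := by
  rw [← Matrix.mulVec_mulVec, Matrix.dotProduct_mulVec, Matrix.vecMul_transpose]

open Classical in
/-- Diagonalisation of a quadratic form in the orthonormal coordinates `R *ᵥ v`. -/
theorem exists_diagonalization {M : Matrix ι ι ℝ} (hM : M.IsHermitian) :
    ∃ R : Matrix ι ι ℝ, ∀ v : ι → ℝ,
      v ⬝ᵥ v = ∑ i, (R *ᵥ v) i ^ 2 ∧ v ⬝ᵥ (M *ᵥ v) = ∑ i, hM.eigenvalues i * (R *ᵥ v) i ^ 2 := by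
  set V : Matrix ι ι ℝ := (hM.eigenvectorUnitary : Matrix ι ι ℝ) with hV
  have hVV : V * Vᵀ = 1 := by
    have := Unitary.coe_mul_star_self hM.eigenvectorUnitary
    simpa [Matrix.star_eq_conjTranspose] using this
  have hspec : M = V * Matrix.diagonal hM.eigenvalues * Vᵀ := by
    conv_lhs => rw [hM.spectral_theorem]
    rw [Unitary.conjStarAlgAut_apply]
    simp [Matrix.star_eq_conjTranspose, hV]
  refine ⟨Vᵀ, fun v => ⟨?_, ?_⟩⟩
  · have : v ⬝ᵥ v = (Vᵀ *ᵥ v) ⬝ᵥ (Vᵀ *ᵥ v) := by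
      rw [← dotProduct_transpose_mul_mulVec, Matrix.transpose_transpose, hVV, Matrix.one_mulVec]
    rw [this]; simp [dotProduct, sq]
  · conv_lhs => rw [hspec]
    rw [← Matrix.mulVec_mulVec, ← Matrix.mulVec_mulVec, Matrix.dotProduct_mulVec,
      ← Matrix.mulVec_transpose]
    simp only [dotProduct, Matrix.mulVec_diagonal]
    exact Finset.sum_congr rfl fun i _ => by ring

theorem eigenvalue_mem_eigenvalueSet [DecidableEq ι] {M : Matrix ι ι ℝ} (hM : M.IsHermitian)
    (i : ι) : hM.eigenvalues i ∈ eigenvalueSet M := by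
  refine ⟨(hM.eigenvectorBasis i).ofLp, fun h => ?_, hM.mulVec_eigenvectorBasis i⟩
  have h1 := hM.eigenvectorBasis.orthonormal.1 i
  rw [show hM.eigenvectorBasis i = 0 from by ext k; exact congrFun h k] at h1
  simp at h1

/-- This and the next bound make the eigenvalue set bounded, so that the infimum and supremum in
`minNormSq` and `specNormSq` really compare with individual eigenvalues. -/
theorem eigenvalueSet_transpose_mul_nonneg (A : Matrix ι κ ℝ) :
    ∀ c ∈ eigenvalueSet (Aᵀ * A), 0 ≤ c := by
  rintro c ⟨v, hv, h⟩
  have h1 := dotProduct_transpose_mul_mulVec A v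
  rw [h, dotProduct_smul, smul_eq_mul] at h1
  have h2 : 0 < v ⬝ᵥ v := lt_of_le_of_ne (dotProduct_self_nonneg v)
    (fun h => hv (dotProduct_self_eq_zero.1 h.symm))
  have h3 := dotProduct_self_nonneg (A *ᵥ v)
  by_contra hc
  push Not at hc
  nlinarith

theorem eigenvalueSet_transpose_mul_le (A : Matrix ι κ ℝ) :
    ∀ c ∈ eigenvalueSet (Aᵀ * A), c ≤ frobSq A := by
  rintro c ⟨v, hv, h⟩
  have h1 := dotProduct_transpose_mul_mulVec A v
  rw [h, dotProduct_smul, smul_eq_mul] at h1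
  have h2 : 0 < v ⬝ᵥ v := lt_of_le_of_ne (dotProduct_self_nonneg v)
    (fun h => hv (dotProduct_self_eq_zero.1 h.symm))
  have h3 := mulVec_dotProduct_self_le A v
  rw [← h1] at h3
  exact le_of_mul_le_mul_right h3 h2

theorem minNormSq_nonneg (A : Matrix ι κ ℝ) : 0 ≤ minNormSq A := by
  unfold minNormSq
  split_ifs
  · exact Real.sInf_nonneg (eigenvalueSet_transpose_mul_nonneg A)
  · refine Real.sInf_nonneg ?_
    simpa using eigenvalueSet_transpose_mul_nonneg Aᵀ

/-- The smallest eigenvalue bounds the quadratic form of a tall matrix from below. -/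
theorem minNormSq_mul_le (A : Matrix ι κ ℝ) (h : Fintype.card κ ≤ Fintype.card ι) (v : κ → ℝ) :
    minNormSq A * (v ⬝ᵥ v) ≤ (A *ᵥ v) ⬝ᵥ (A *ᵥ v) := by
  classical
  have hM := isHermitian_transpose_mul A
  obtain ⟨R, hR⟩ := exists_diagonalization hM
  rw [← dotProduct_transpose_mul_mulVec, (hR v).1, (hR v).2, Finset.mul_sum]
  refine Finset.sum_le_sum fun i _ => mul_le_mul_of_nonneg_right ?_ (sq_nonneg _)
  rw [minNormSq, if_pos h]
  exact csInf_le ⟨0, eigenvalueSet_transpose_mul_nonneg A⟩ (eigenvalue_mem_eigenvalueSet hM i)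

/-- The squared Frobenius norm is the trace of `A'A`, a sum of as many eigenvalues as `A` has
columns. For the loadings this number is `d` or `r`, so the loss is a constant. -/
theorem frobSq_le_card_mul_specNormSq (A : Matrix ι κ ℝ) :
    frobSq A ≤ Fintype.card κ * specNormSq A := by
  classical
  have hM := isHermitian_transpose_mul A
  rw [frobSq_eq_trace, hM.trace_eq_sum_eigenvalues, ← nsmul_eq_mul, ← Finset.card_univ]
  refine Finset.sum_le_card_nsmul _ _ _ fun i _ => ?_
  exact le_csSup ⟨frobSq A, eigenvalueSet_transpose_mul_le A⟩ (eigenvalue_mem_eigenvalueSet hM i)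

open Classical in
/-- The max–min bound of Courant and Fischer. -/
theorem le_eigenvalues₀_of_le_on_range {M : Matrix ι ι ℝ} (hM : M.IsHermitian) {d : ℕ}
    (A : Matrix ι (Fin d) ℝ) (hA : ∀ x, A *ᵥ x = 0 → x = 0) (c : ℝ)
    (hc : ∀ x, c * ((A *ᵥ x) ⬝ᵥ (A *ᵥ x)) ≤ (A *ᵥ x) ⬝ᵥ (M *ᵥ (A *ᵥ x)))
    (hd : d ≤ Fintype.card ι) (j : Fin d) : c ≤ hM.eigenvalues₀ (Fin.castLE hd j) := by
  obtain ⟨R, hR⟩ := exists_diagonalization hM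
  -- The enumeration through which `eigenvalues` is defined from the ordered list `eigenvalues₀`.
  let e : Fin (Fintype.card ι) ≃ ι := Fintype.equivOfCardEq (Fintype.card_fin _)
  -- `φ` reads the coordinates of `A x` along the `j` leading eigenvectors. As `j < d` it has a
  -- nonzero kernel vector, and there the quadratic form only sees eigenvalues from position `j` on.
  let φ : (Fin d → ℝ) →ₗ[ℝ] (Fin j → ℝ) :=
    ((R * A).submatrix (fun k : Fin j => e ⟨k, by have := j.2; have := k.2; omega⟩) id).mulVecLin
  have hφ : LinearMap.ker φ ≠ ⊥ := LinearMap.ker_ne_bot_of_finrank_lt (by simp)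
  obtain ⟨x, hx, hx0⟩ := Submodule.exists_mem_ne_zero_of_ne_bot hφ
  set v := A *ᵥ x with hv
  have hv0 : 0 < v ⬝ᵥ v := lt_of_le_of_ne (dotProduct_self_nonneg v)
    (fun h => hx0 (hA x (dotProduct_self_eq_zero.1 h.symm)))
  have hzero : ∀ i : ι, (e.symm i : ℕ) < j → (R *ᵥ v) i = 0 := fun i hi => by
    have h1 := congrFun (LinearMap.mem_ker.1 hx) ⟨e.symm i, hi⟩
    have h2 : (φ x) ⟨e.symm i, hi⟩ = ((R * A) *ᵥ x) i := by
      simp only [φ, Matrix.mulVecLin_apply, Matrix.mulVec, dotProduct, Matrix.submatrix_apply, id]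
      simp
    rw [hv, Matrix.mulVec_mulVec, ← h2, h1]
    rfl
  have hle : v ⬝ᵥ (M *ᵥ v) ≤ hM.eigenvalues₀ (Fin.castLE hd j) * (v ⬝ᵥ v) := by
    rw [(hR v).1, (hR v).2, Finset.mul_sum]
    refine Finset.sum_le_sum fun i _ => ?_
    by_cases hi : (e.symm i : ℕ) < j
    · simp [hzero i hi]
    · refine mul_le_mul_of_nonneg_right ?_ (sq_nonneg _)
      exact hM.eigenvalues₀_antitone (Fin.le_def.2 (by simpa using not_lt.1 hi))
  exact le_of_mul_le_mul_right ((hc x).trans hle) hv0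

/-! ### Perturbation of the leading eigenspace -/

/-- The orthogonal projection onto the column space of `A`. -/
def colProj [DecidableEq κ] (A : Matrix ι κ ℝ) : Matrix ι ι ℝ := A * (Aᵀ * A)⁻¹ * Aᵀ

theorem isUnit_det_transpose_mul [DecidableEq κ] (A : Matrix ι κ ℝ)
    (hA : ∀ x, A *ᵥ x = 0 → x = 0) : IsUnit (Aᵀ * A).det := by
  rw [← Matrix.isUnit_iff_isUnit_det, ← Matrix.mulVec_injective_iff_isUnit]
  intro x y hxy
  have h : (Aᵀ * A) *ᵥ (x - y) = 0 := by
    rw [Matrix.mulVec_sub]; exact sub_eq_zero.2 hxy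
  have h1 := dotProduct_transpose_mul_mulVec A (x - y)
  rw [h, dotProduct_zero] at h1
  exact sub_eq_zero.1 (hA _ (dotProduct_self_eq_zero.1 h1.symm))

theorem colProj_mul_self [DecidableEq κ] (A : Matrix ι κ ℝ)
    (hA : ∀ x, A *ᵥ x = 0 → x = 0) : colProj A * A = A := by
  rw [colProj, Matrix.mul_assoc, Matrix.mul_assoc,
    Matrix.nonsing_inv_mul _ (isUnit_det_transpose_mul A hA), Matrix.mul_one]

theorem colProj_mul_colProj [DecidableEq κ] (A : Matrix ι κ ℝ)
    (hA : ∀ x, A *ᵥ x = 0 → x = 0) : colProj A * colProj A = colProj A := by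
  conv_lhs => enter [2]; rw [colProj]
  rw [← Matrix.mul_assoc, ← Matrix.mul_assoc, colProj_mul_self A hA, colProj]

theorem colProj_transpose [DecidableEq κ] (A : Matrix ι κ ℝ) : (colProj A)ᵀ = colProj A := by
  simp [colProj, Matrix.transpose_mul, Matrix.transpose_nonsing_inv, Matrix.mul_assoc]

theorem dotProduct_one_sub_colProj [DecidableEq ι] [DecidableEq κ] (A : Matrix ι κ ℝ)
    (hA : ∀ x, A *ᵥ x = 0 → x = 0) (v : ι → ℝ) :
    ((1 - colProj A) *ᵥ v) ⬝ᵥ ((1 - colProj A) *ᵥ v) = v ⬝ᵥ v - v ⬝ᵥ (colProj A *ᵥ v) := by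
  rw [← dotProduct_transpose_mul_mulVec, Matrix.transpose_sub, Matrix.transpose_one,
    colProj_transpose, Matrix.mul_sub, Matrix.sub_mul, Matrix.sub_mul, colProj_mul_colProj A hA]
  simp [Matrix.sub_mulVec, dotProduct_sub]

theorem dotProduct_colProj_nonneg [DecidableEq κ] (A : Matrix ι κ ℝ)
    (hA : ∀ x, A *ᵥ x = 0 → x = 0) (v : ι → ℝ) : 0 ≤ v ⬝ᵥ (colProj A *ᵥ v) := by
  have := dotProduct_transpose_mul_mulVec (colProj A) v
  rw [colProj_transpose, colProj_mul_colProj A hA] at this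
  rw [this]
  exact dotProduct_self_nonneg _

theorem frobSq_one_sub_colProj_mul_le {η : Type*} [Fintype η] [DecidableEq ι] [DecidableEq κ]
    (A : Matrix ι κ ℝ) (hA : ∀ x, A *ᵥ x = 0 → x = 0) (W : Matrix ι η ℝ) :
    frobSq ((1 - colProj A) * W) ≤ frobSq W := by
  rw [← frobSq_transpose, ← frobSq_transpose W]
  refine Finset.sum_le_sum fun k _ => ?_
  have h1 := dotProduct_one_sub_colProj A hA (Wᵀ k)
  have h2 := dotProduct_colProj_nonneg A hA (Wᵀ k)
  have h3 : ((1 - colProj A) *ᵥ (Wᵀ k)) ⬝ᵥ ((1 - colProj A) *ᵥ (Wᵀ k)) ≤ (Wᵀ k) ⬝ᵥ (Wᵀ k) := by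
    linarith
  simpa [dotProduct, sq, Matrix.mul_apply, Matrix.mulVec] using h3

/-- With `P` the projection onto the columns of `A`, the trace is the sum of `u_j · P u_j` over the
orthonormal columns, and `1 - u_j · P u_j = ‖(1 - P) u_j‖²`. The distance can thus be bounded one
eigenvector at a time. -/
theorem spaceDist_sq [DecidableEq ι] {d : ℕ} (hd : 0 < d) (U A : Matrix ι (Fin d) ℝ)
    (hA : ∀ x, A *ᵥ x = 0 → x = 0) (hU : Uᵀ * U = 1) :
    spaceDist U A ^ 2 =
      (∑ j, ((1 - colProj A) *ᵥ Uᵀ j) ⬝ᵥ ((1 - colProj A) *ᵥ Uᵀ j)) / d := by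
  have hcol : ∀ j, Uᵀ j ⬝ᵥ Uᵀ j = 1 := fun j => by
    have := congrFun (congrFun hU j) j
    simpa [Matrix.mul_apply, dotProduct] using this
  have htr : ((U * (Uᵀ * U)⁻¹ * Uᵀ) * (A * (Aᵀ * A)⁻¹ * Aᵀ)).trace =
      ∑ j, Uᵀ j ⬝ᵥ (colProj A *ᵥ Uᵀ j) := by
    rw [hU, inv_one, Matrix.mul_one, Matrix.mul_assoc, Matrix.trace_mul_comm]
    change (Uᵀ * colProj A * U).trace = _
    rw [Matrix.mul_assoc]
    simp only [Matrix.trace, Matrix.diag, Matrix.mul_apply, dotProduct, Matrix.mulVec,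
      Matrix.transpose_apply]
  have hd' : (d : ℝ) ≠ 0 := by positivity
  have key : 1 - (∑ j, Uᵀ j ⬝ᵥ (colProj A *ᵥ Uᵀ j)) / ((max d d : ℕ) : ℝ) =
      (∑ j, ((1 - colProj A) *ᵥ Uᵀ j) ⬝ᵥ ((1 - colProj A) *ᵥ Uᵀ j)) / d := by
    simp only [dotProduct_one_sub_colProj A hA, hcol, Finset.sum_sub_distrib, max_self]
    simp
    field_simp
  rw [spaceDist, htr, key, Real.sq_sqrt]
  exact div_nonneg (Finset.sum_nonneg fun _ _ => dotProduct_self_nonneg _) (by positivity)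

/-- The leading left singular space of `What` is close to the column space of `A` when `What` is
close to a matrix `W = A G` whose singular values on that column space are bounded below. -/
theorem mul_spaceDist_sq_le {d : ℕ} (hd : 0 < d) (U A : Matrix ι (Fin d) ℝ)
    (hA : ∀ x, A *ᵥ x = 0 → x = 0) (W What : Matrix ι κ ℝ) (G : Matrix (Fin d) κ ℝ)
    (hW : W = A * G) (hU : IsLeadingEigenvectors (What * Whatᵀ) U) (s : ℝ)
    (hs : ∀ x, s * ((A *ᵥ x) ⬝ᵥ (A *ᵥ x)) ≤ (Wᵀ *ᵥ (A *ᵥ x)) ⬝ᵥ (Wᵀ *ᵥ (A *ᵥ x))) :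
    s * spaceDist U A ^ 2 ≤ 4 * frobSq (What - W) := by
  classical
  obtain ⟨hUU, hM, hdι, hev⟩ := hU
  set D := frobSq (What - W) with hD
  have hD0 : 0 ≤ D := frobSq_nonneg _
  have hcol : ∀ j, Uᵀ j ⬝ᵥ Uᵀ j = 1 := fun j => by
    have := congrFun (congrFun hUU j) j
    simpa [Matrix.mul_apply, dotProduct] using this
  rw [spaceDist_sq hd U A hA hUU]
  set Q := (1 : Matrix ι ι ℝ) - colProj A with hQ
  have hd' : (0 : ℝ) < d := by positivity
  suffices h : ∀ j, s * ((Q *ᵥ Uᵀ j) ⬝ᵥ (Q *ᵥ Uᵀ j)) ≤ 4 * D by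
    rw [← mul_div_assoc, div_le_iff₀ hd', Finset.mul_sum]
    calc _ ≤ ∑ _j : Fin d, 4 * D := Finset.sum_le_sum fun j _ => h j
      _ = _ := by simp [mul_comm]
  intro j
  have hq0 := dotProduct_self_nonneg (Q *ᵥ Uᵀ j)
  -- When the error is not small against the signal, `‖Q u_j‖ ≤ 1` already suffices.
  rcases le_or_gt s (4 * D) with hsD | hsD
  · have h1 := dotProduct_one_sub_colProj A hA (Uᵀ j)
    have h2 := dotProduct_colProj_nonneg A hA (Uᵀ j)
    rw [← hQ, hcol] at h1
    rcases le_or_gt s 0 with h0 | h0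
    · nlinarith
    · nlinarith
  have hs0 : 0 < s := by linarith
  -- On the column space of `A`, `‖W'v‖² ≤ 2‖Ŵ'v‖² + 2D‖v‖²`. Hence `‖Ŵ'v‖² ≥ (s/2 - D)‖v‖² ≥
  -- (s/4)‖v‖²`, and the max–min bound carries this over to the leading eigenvalues.
  have hlam : s / 4 ≤ hM.eigenvalues₀ (Fin.castLE hdι j) := by
    refine le_eigenvalues₀_of_le_on_range hM A hA _ (fun x => ?_) hdι j
    set v := A *ᵥ x
    have h1 := hs x
    have h2 : v ⬝ᵥ ((What * Whatᵀ) *ᵥ v) = (Whatᵀ *ᵥ v) ⬝ᵥ (Whatᵀ *ᵥ v) := by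
      simpa using dotProduct_transpose_mul_mulVec Whatᵀ v
    have h3 := mulVec_dotProduct_self_le (What - W)ᵀ v
    rw [frobSq_transpose, ← hD, Matrix.transpose_sub, Matrix.sub_mulVec] at h3
    set a := Whatᵀ *ᵥ v
    set b := Wᵀ *ᵥ v
    have h4 : b ⬝ᵥ b ≤ 2 * (a ⬝ᵥ a) + 2 * ((a - b) ⬝ᵥ (a - b)) := by
      have h5 := dotProduct_self_nonneg ((2 : ℝ) • a - b)
      have h6 : b ⬝ᵥ a = a ⬝ᵥ b := dotProduct_comm _ _
      simp only [dotProduct_sub, sub_dotProduct, dotProduct_smul, smul_dotProduct,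
        smul_eq_mul] at h5 ⊢
      linarith
    have h7 := dotProduct_self_nonneg v
    rw [h2]
    nlinarith
  set lam := hM.eigenvalues₀ (Fin.castLE hdι j)
  have hev' : (What * Whatᵀ) *ᵥ Uᵀ j = lam • Uᵀ j := hev j
  have hlam0 : 0 < lam := by linarith
  have hw : (Whatᵀ *ᵥ Uᵀ j) ⬝ᵥ (Whatᵀ *ᵥ Uᵀ j) = lam := by
    have h2 := dotProduct_transpose_mul_mulVec Whatᵀ (Uᵀ j)
    rw [Matrix.transpose_transpose, hev', dotProduct_smul, hcol] at h2
    simpa using h2.symm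
  -- `Q` annihilates the column space of `A`, hence `W`. So `λ Q u_j = Q Ŵ Ŵ' u_j` involves only the
  -- error, while `‖Ŵ' u_j‖² = λ`; together `λ ‖Q u_j‖² ≤ D`.
  have hQW : Q * What = Q * (What - W) := by
    have : Q * W = 0 := by
      rw [hW, ← Matrix.mul_assoc, hQ, Matrix.sub_mul, colProj_mul_self A hA]; simp
    rw [Matrix.mul_sub, this, sub_zero]
  have hQv : (Q * What) *ᵥ (Whatᵀ *ᵥ Uᵀ j) = lam • (Q *ᵥ Uᵀ j) := by
    rw [← Matrix.mulVec_mulVec, Matrix.mulVec_mulVec _ What, hev', Matrix.mulVec_smul]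
  have h8 := mulVec_dotProduct_self_le (Q * What) (Whatᵀ *ᵥ Uᵀ j)
  rw [hQv, hw, hQW] at h8
  have h9 : frobSq (Q * (What - W)) ≤ D := frobSq_one_sub_colProj_mul_le A hA _
  simp only [dotProduct_smul, smul_dotProduct, smul_eq_mul] at h8
  have h10 : lam * ((Q *ᵥ Uᵀ j) ⬝ᵥ (Q *ᵥ Uᵀ j)) ≤ D := by
    refine le_of_mul_le_mul_left ?_ hlam0
    nlinarith
  nlinarith

end LinearAlgebra

/-! ### The covariance inequality under strong mixing -/

section Mixing

variable {Ω : Type*} {m0 : MeasurableSpace Ω} {μ : Measure Ω} [IsProbabilityMeasure μ]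

theorem integrable_of_abs_le {f : Ω → ℝ} (hf : Measurable f) {M : ℝ} (h : ∀ ω, |f ω| ≤ M) :
    Integrable f μ :=
  Integrable.of_bound hf.aestronglyMeasurable M (ae_of_all _ h)

/-- The covariance with a bounded `F`-measurable variable is dominated by that with the indicator
of an event of `F`. -/
theorem exists_indicator_covariance_bound {F : MeasurableSpace Ω} (hF : F ≤ m0) {U V : Ω → ℝ}
    (hU : Measurable[F] U) {M : ℝ} (hM : 0 ≤ M) (hUM : ∀ ω, |U ω| ≤ M) (hV : Integrable V μ) :
    ∃ A, MeasurableSet[F] A ∧ |∫ ω, U ω * V ω ∂μ - (∫ ω, U ω ∂μ) * ∫ ω, V ω ∂μ| ≤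
      2 * M * |∫ ω in A, V ω ∂μ - μ.real A * ∫ ω, V ω ∂μ| := by
  set b := ∫ ω, V ω ∂μ with hb
  set V0 : Ω → ℝ := fun ω => V ω - b with hV0
  have hV0i : Integrable V0 μ := hV.sub (integrable_const _)
  have hUm : Measurable[m0] U := hU.mono hF le_rfl
  have hUi : Integrable U μ := integrable_of_abs_le hUm hUM
  have hUV : Integrable (fun ω => U ω * V ω) μ :=
    hV.bdd_mul hUm.aestronglyMeasurable (ae_of_all _ hUM)
  have hUV0 : Integrable (fun ω => U ω * V0 ω) μ :=
    hV0i.bdd_mul hUm.aestronglyMeasurable (ae_of_all _ hUM)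
  -- Conditioning on `F` bounds the covariance by `M E|g|`. Since `g` has mean zero, `E|g|` is twice
  -- its integral over the event `g ≥ 0`, which belongs to `F`.
  set g := μ[V0|F] with hg
  have hgi : Integrable g μ := integrable_condExp
  have hgm : StronglyMeasurable[F] g := stronglyMeasurable_condExp
  refine ⟨{ω | 0 ≤ g ω}, hgm.measurable measurableSet_Ici, ?_⟩
  set A := {ω | 0 ≤ g ω} with hAdef
  have hA : MeasurableSet[F] A := hgm.measurable measurableSet_Ici
  have hA0 : MeasurableSet[m0] A := hF _ hA
  have h1 : ∫ ω, U ω * V ω ∂μ - (∫ ω, U ω ∂μ) * b = ∫ ω, U ω * V0 ω ∂μ := by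
    simp only [hV0, mul_sub]
    rw [integral_sub hUV (hUi.mul_const b), integral_mul_const]
  have h2 : ∫ ω, U ω * V0 ω ∂μ = ∫ ω, U ω * g ω ∂μ := by
    rw [← integral_condExp hF]
    exact integral_congr_ae
      (condExp_mul_of_stronglyMeasurable_left hU.stronglyMeasurable hUV0 hV0i)
  have h3 : |∫ ω, U ω * g ω ∂μ| ≤ M * ∫ ω, |g ω| ∂μ := by
    rw [← integral_const_mul]
    refine (abs_integral_le_integral_abs).trans
      (integral_mono_of_nonneg (ae_of_all _ fun _ => abs_nonneg _) (hgi.abs.const_mul M)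
        (ae_of_all _ fun ω => ?_))
    simp only [abs_mul]
    exact mul_le_mul_of_nonneg_right (hUM ω) (abs_nonneg _)
  have hg0 : ∫ ω, g ω ∂μ = 0 := by
    rw [hg, integral_condExp hF, hV0, integral_sub hV (integrable_const _)]
    simp [hb]
  have h4 : ∫ ω, |g ω| ∂μ = 2 * ∫ ω in A, g ω ∂μ := by
    have e1 := integral_add_compl hA0 hgi.abs
    have e2 := integral_add_compl hA0 hgi
    have e3 : ∫ ω in A, |g ω| ∂μ = ∫ ω in A, g ω ∂μ :=
      setIntegral_congr_fun hA0 fun ω (hω : 0 ≤ g ω) => abs_of_nonneg hω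
    have e4 : ∫ ω in Aᶜ, |g ω| ∂μ = -∫ ω in Aᶜ, g ω ∂μ := by
      rw [← integral_neg]
      exact setIntegral_congr_fun hA0.compl fun ω (hω : ¬ 0 ≤ g ω) =>
        abs_of_neg (not_le.1 hω)
    linarith
  have h5 : ∫ ω in A, g ω ∂μ = ∫ ω in A, V ω ∂μ - μ.real A * b := by
    rw [hg, setIntegral_condExp hF hV0i hA, hV0,
      integral_sub hV.integrableOn (integrable_const _).integrableOn]
    simp
  rw [h1, h2]
  calc _ ≤ M * ∫ ω, |g ω| ∂μ := h3
    _ = 2 * M * (∫ ω in A, V ω ∂μ - μ.real A * b) := by rw [h4, h5]; ring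
    _ ≤ _ := mul_le_mul_of_nonneg_left (le_abs_self _) (by positivity)

/-- Covariance inequality for bounded variables. -/
theorem abs_covariance_le_of_bounded {F G : MeasurableSpace Ω} (hF : F ≤ m0) (hG : G ≤ m0) {α : ℝ}
    (hα : ∀ A B, MeasurableSet[F] A → MeasurableSet[G] B →
      |μ.real (A ∩ B) - μ.real A * μ.real B| ≤ α)
    {U V : Ω → ℝ} (hU : Measurable[F] U) (hV : Measurable[G] V) {M : ℝ} (hM : 0 ≤ M)
    (hUM : ∀ ω, |U ω| ≤ M) (hVM : ∀ ω, |V ω| ≤ M) :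
    |∫ ω, U ω * V ω ∂μ - (∫ ω, U ω ∂μ) * ∫ ω, V ω ∂μ| ≤ 4 * α * M ^ 2 := by
  have hVi : Integrable V μ := integrable_of_abs_le (hV.mono hG le_rfl) hVM
  obtain ⟨A, hA, h1⟩ := exists_indicator_covariance_bound hF hU hM hUM hVi
  have hA0 : MeasurableSet[m0] A := hF _ hA
  -- The same reduction with the roles exchanged: `V` is tested against the indicator of `A`, which
  -- leaves a pair of events.
  obtain ⟨B, hB, h2⟩ := exists_indicator_covariance_bound (V := A.indicator 1) hG hV hM hVM
    ((integrable_const (μ := μ) (1 : ℝ)).indicator hA0)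
  have e1 : ∫ ω, V ω * A.indicator 1 ω ∂μ = ∫ ω in A, V ω ∂μ := by
    rw [← integral_indicator hA0]
    congr 1; ext ω
    by_cases h : ω ∈ A <;> simp [h]
  have e2 : ∫ ω, A.indicator (1 : Ω → ℝ) ω ∂μ = μ.real A := integral_indicator_one hA0
  have e3 : ∫ ω in B, A.indicator (1 : Ω → ℝ) ω ∂μ = μ.real (A ∩ B) := by
    rw [integral_indicator_one hA0, measureReal_restrict_apply hA0]
  rw [e1, e2, e3, mul_comm (∫ ω, V ω ∂μ), mul_comm (μ.real B)] at h2
  have h3 := hα A B hA hB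
  calc _ ≤ _ := h1
    _ ≤ 2 * M * (2 * M * α) := mul_le_mul_of_nonneg_left
        (h2.trans (mul_le_mul_of_nonneg_left h3 (by positivity))) (by positivity)
    _ = _ := by ring

/-- Truncation of a real number to the window `[-M, M]` by zero. -/
def truncate (M x : ℝ) : ℝ := if |x| ≤ M then x else 0

theorem measurable_truncate (M : ℝ) : Measurable (truncate M) :=
  Measurable.ite (measurableSet_le measurable_id.abs measurable_const) measurable_id
    measurable_const

theorem abs_truncate_le {M : ℝ} (hM : 0 ≤ M) (x : ℝ) : |truncate M x| ≤ M := by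
  unfold truncate; split_ifs with h <;> simp [h, hM]

theorem abs_truncate_le_abs (M x : ℝ) : |truncate M x| ≤ |x| := by
  unfold truncate; split_ifs <;> simp

/-- The exponent `2 - q` is negative, so above the truncation level a square is paid for by the
`q`-th power with a gain. All truncation errors below rest on this. -/
theorem sq_le_rpow_mul {q M x : ℝ} (hq : 2 < q) (hM : 1 ≤ M) (hx : M ≤ x) :
    x ^ 2 ≤ x ^ q * M ^ (2 - q) := by
  have hM0 : 0 < M := by linarith
  have hx0 : 0 < x := by linarith
  have h1 : x ^ (2 - q) ≤ M ^ (2 - q) :=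
    Real.rpow_le_rpow_of_nonpos hM0 hx (by linarith)
  calc x ^ 2 = x ^ q * x ^ (2 - q) := by
        rw [← Real.rpow_add hx0]; norm_num
    _ ≤ _ := mul_le_mul_of_nonneg_left h1 (by positivity)

theorem abs_sub_truncate_le {q M : ℝ} (hq : 2 < q) (hM : 1 ≤ M) (x : ℝ) :
    |x - truncate M x| ≤ |x| ^ q * M ^ (2 - q) := by
  unfold truncate
  split_ifs with h
  · simp only [sub_self, abs_zero]; positivity
  · push Not at h
    have h1 := sq_le_rpow_mul hq hM h.le
    rw [sub_zero]
    nlinarith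

theorem abs_mul_sub_truncate_le {q M : ℝ} (hq : 2 < q) (hM : 1 ≤ M) (x y : ℝ) :
    |x * y - truncate M x * truncate M y| ≤ (|x| ^ q + |y| ^ q) * M ^ (2 - q) := by
  have hM0 : 0 < M := by linarith
  have hx : 0 ≤ |x| ^ q * M ^ (2 - q) := by positivity
  have hy : 0 ≤ |y| ^ q * M ^ (2 - q) := by positivity
  have key : M < max |x| |y| → |x * y| ≤ (|x| ^ q + |y| ^ q) * M ^ (2 - q) := fun h => by
    rw [abs_mul, add_mul]
    rcases le_total |x| |y| with hxy | hxy
    · rw [max_eq_right hxy] at h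
      have := sq_le_rpow_mul hq hM h.le
      nlinarith [abs_nonneg x, abs_nonneg y]
    · rw [max_eq_left hxy] at h
      have := sq_le_rpow_mul hq hM h.le
      nlinarith [abs_nonneg x, abs_nonneg y]
  unfold truncate
  split_ifs with h1 h2 h2
  · simp only [sub_self, abs_zero]; positivity
  · simpa using key (lt_max_of_lt_right (not_le.1 h2))
  · simpa using key (lt_max_of_lt_left (not_le.1 h1))
  · simpa using key (lt_max_of_lt_left (not_le.1 h1))

theorem abs_le_one_add_rpow {q : ℝ} (hq : 1 ≤ q) (x : ℝ) : |x| ≤ 1 + |x| ^ q := by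
  have h0 : 0 ≤ |x| ^ q := by positivity
  rcases le_total |x| 1 with h | h
  · linarith
  · have := Real.rpow_le_rpow_of_exponent_le h hq
    rw [Real.rpow_one] at this
    linarith

/-- The truncated pair falls under the bounded case. Truncation costs `2C M^{2-q}` in the mean of
the product and `2C(1 + C) M^{2-q}` in the product of the means. -/
theorem abs_covariance_le_of_truncate {F G : MeasurableSpace Ω} (hF : F ≤ m0) (hG : G ≤ m0)
    {α : ℝ} (hα : ∀ A B, MeasurableSet[F] A → MeasurableSet[G] B →
      |μ.real (A ∩ B) - μ.real A * μ.real B| ≤ α)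
    {U V : Ω → ℝ} (hU : Measurable[F] U) (hV : Measurable[G] V) {q C : ℝ} (hq : 2 < q)
    (hUq : Integrable (fun ω => |U ω| ^ q) μ) (hVq : Integrable (fun ω => |V ω| ^ q) μ)
    (hUC : ∫ ω, |U ω| ^ q ∂μ ≤ C) (hVC : ∫ ω, |V ω| ^ q ∂μ ≤ C) (hUi : Integrable U μ)
    (hVi : Integrable V μ) (hUV : Integrable (fun ω => U ω * V ω) μ) {M : ℝ} (hM : 1 ≤ M) :
    |∫ ω, U ω * V ω ∂μ - (∫ ω, U ω ∂μ) * ∫ ω, V ω ∂μ| ≤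
      4 * α * M ^ 2 + 2 * C * (2 + C) * M ^ (2 - q) := by
  have hM0 : 0 ≤ M := by linarith
  set U1 := fun ω => truncate M (U ω) with hU1
  set V1 := fun ω => truncate M (V ω) with hV1
  have hU1m : Measurable[F] U1 := (measurable_truncate M).comp hU
  have hV1m : Measurable[G] V1 := (measurable_truncate M).comp hV
  have hU1i : Integrable U1 μ :=
    integrable_of_abs_le (hU1m.mono hF le_rfl) fun ω => abs_truncate_le hM0 _
  have hV1i : Integrable V1 μ :=
    integrable_of_abs_le (hV1m.mono hG le_rfl) fun ω => abs_truncate_le hM0 _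
  have hUV1 : Integrable (fun ω => U1 ω * V1 ω) μ :=
    hV1i.bdd_mul (hU1m.mono hF le_rfl).aestronglyMeasurable
      (ae_of_all _ fun ω => abs_truncate_le hM0 (U ω))
  have hmain := abs_covariance_le_of_bounded hF hG hα hU1m hV1m hM0
    (fun ω => abs_truncate_le hM0 _) (fun ω => abs_truncate_le hM0 _)
  set κ := M ^ (2 - q) with hκ
  have hκ0 : 0 ≤ κ := by positivity
  have hC : 0 ≤ C := (integral_nonneg fun ω => by positivity).trans hUC
  have d1 : |∫ ω, U ω * V ω ∂μ - ∫ ω, U1 ω * V1 ω ∂μ| ≤ 2 * C * κ := by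
    rw [← integral_sub hUV hUV1]
    calc _ ≤ ∫ ω, (|U ω| ^ q + |V ω| ^ q) * κ ∂μ :=
          abs_integral_le_integral_abs.trans (integral_mono_of_nonneg
            (ae_of_all _ fun _ => abs_nonneg _) ((hUq.add hVq).mul_const κ)
            (ae_of_all _ fun ω => abs_mul_sub_truncate_le hq hM _ _))
      _ = (∫ ω, |U ω| ^ q ∂μ + ∫ ω, |V ω| ^ q ∂μ) * κ := by
          rw [integral_mul_const, integral_add hUq hVq]
      _ ≤ _ := mul_le_mul_of_nonneg_right (by linarith) hκ0
  have d2 : ∀ Z : Ω → ℝ, Integrable (fun ω => |Z ω| ^ q) μ → ∫ ω, |Z ω| ^ q ∂μ ≤ C →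
      Integrable Z μ → Integrable (fun ω => truncate M (Z ω)) μ →
      |∫ ω, Z ω ∂μ - ∫ ω, truncate M (Z ω) ∂μ| ≤ C * κ := fun Z hZq hZC hZi hZ1 => by
    rw [← integral_sub hZi hZ1]
    calc _ ≤ ∫ ω, |Z ω| ^ q * κ ∂μ :=
          abs_integral_le_integral_abs.trans (integral_mono_of_nonneg
            (ae_of_all _ fun _ => abs_nonneg _) (hZq.mul_const κ)
            (ae_of_all _ fun ω => abs_sub_truncate_le hq hM _))
      _ = (∫ ω, |Z ω| ^ q ∂μ) * κ := integral_mul_const _ _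
      _ ≤ _ := mul_le_mul_of_nonneg_right hZC hκ0
  have d3 : ∀ Z Z' : Ω → ℝ, Integrable (fun ω => |Z ω| ^ q) μ → ∫ ω, |Z ω| ^ q ∂μ ≤ C →
      (∀ ω, |Z' ω| ≤ |Z ω|) → |∫ ω, Z' ω ∂μ| ≤ 1 + C := fun Z Z' hZq hZC hZ' => by
    calc _ ≤ ∫ ω, (1 + |Z ω| ^ q) ∂μ :=
          abs_integral_le_integral_abs.trans (integral_mono_of_nonneg
            (ae_of_all _ fun _ => abs_nonneg _) ((integrable_const 1).add hZq)
            (ae_of_all _ fun ω => (hZ' ω).trans (abs_le_one_add_rpow (by linarith) _)))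
      _ = 1 + ∫ ω, |Z ω| ^ q ∂μ := by
          rw [integral_add (integrable_const 1) hZq]; simp
      _ ≤ _ := by linarith
  have a1 := d2 U hUq hUC hUi hU1i
  have a2 := d2 V hVq hVC hVi hV1i
  have a3 := d3 V V hVq hVC fun _ => le_rfl
  have a4 := d3 U U1 hUq hUC fun _ => abs_truncate_le_abs _ _
  set x := ∫ ω, U ω ∂μ
  set y := ∫ ω, V ω ∂μ
  change |x - ∫ ω, U1 ω ∂μ| ≤ _ at a1
  change |y - ∫ ω, V1 ω ∂μ| ≤ _ at a2
  set x1 := ∫ ω, U1 ω ∂μ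
  set y1 := ∫ ω, V1 ω ∂μ
  have d4 : |x1 * y1 - x * y| ≤ 2 * C * (1 + C) * κ := by
    have : x1 * y1 - x * y = -(x1 * (y - y1) + (x - x1) * y) := by ring
    rw [this, abs_neg]
    refine (abs_add_le _ _).trans ?_
    rw [abs_mul, abs_mul]
    have b1 : |x1| * |y - y1| ≤ (1 + C) * (C * κ) :=
      mul_le_mul a4 a2 (abs_nonneg _) (by positivity)
    have b2 : |x - x1| * |y| ≤ (C * κ) * (1 + C) :=
      mul_le_mul a1 a3 (abs_nonneg _) (by positivity)
    linarith
  have e : ∫ ω, U ω * V ω ∂μ - x * y = (∫ ω, U ω * V ω ∂μ - ∫ ω, U1 ω * V1 ω ∂μ) +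
      (∫ ω, U1 ω * V1 ω ∂μ - x1 * y1) + (x1 * y1 - x * y) := by ring
  rw [e]
  have := abs_add_three (∫ ω, U ω * V ω ∂μ - ∫ ω, U1 ω * V1 ω ∂μ)
      (∫ ω, U1 ω * V1 ω ∂μ - x1 * y1) (x1 * y1 - x * y)
  linarith

/-- **Davydov's covariance inequality** with equal moment orders, without optimal constants. -/
theorem abs_covariance_le_rpow {F G : MeasurableSpace Ω} (hF : F ≤ m0) (hG : G ≤ m0)
    {α : ℝ} (hα : ∀ A B, MeasurableSet[F] A → MeasurableSet[G] B →
      |μ.real (A ∩ B) - μ.real A * μ.real B| ≤ α) (hα1 : α ≤ 1)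
    {U V : Ω → ℝ} (hU : Measurable[F] U) (hV : Measurable[G] V) {q C : ℝ} (hq : 2 < q)
    (hUq : Integrable (fun ω => |U ω| ^ q) μ) (hVq : Integrable (fun ω => |V ω| ^ q) μ)
    (hUC : ∫ ω, |U ω| ^ q ∂μ ≤ C) (hVC : ∫ ω, |V ω| ^ q ∂μ ≤ C) (hUi : Integrable U μ)
    (hVi : Integrable V μ) (hUV : Integrable (fun ω => U ω * V ω) μ) :
    |∫ ω, U ω * V ω ∂μ - (∫ ω, U ω ∂μ) * ∫ ω, V ω ∂μ| ≤
      (4 + 2 * C * (2 + C)) * α ^ (1 - 2 / q) := by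
  have hα0 : 0 ≤ α := (abs_nonneg _).trans (hα ∅ ∅ (by simp) (by simp))
  have hq0 : 0 < q := by linarith
  -- The level `M = a^{-1/q}` balances the two terms: `a M²` and `M^{2-q}` both equal `a^{1-2/q}`.
  -- Allowing any `a ≥ α` covers `α = 0` by letting `a` decrease to zero.
  have key : ∀ a, α ≤ a → 0 < a → a ≤ 1 →
      |∫ ω, U ω * V ω ∂μ - (∫ ω, U ω ∂μ) * ∫ ω, V ω ∂μ| ≤
        (4 + 2 * C * (2 + C)) * a ^ (1 - 2 / q) := fun a ha ha0 ha1 => by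
    have hM : 1 ≤ a ^ (-(1 / q)) :=
      Real.one_le_rpow_of_pos_of_le_one_of_nonpos ha0 ha1 (by simp; positivity)
    have := abs_covariance_le_of_truncate hF hG (fun A B hA hB => (hα A B hA hB).trans ha)
      hU hV hq hUq hVq hUC hVC hUi hVi hUV hM
    have e1 : a * (a ^ (-(1 / q))) ^ 2 = a ^ (1 - 2 / q) := by
      rw [← Real.rpow_natCast, ← Real.rpow_mul ha0.le]
      nth_rewrite 1 [← Real.rpow_one a]
      rw [← Real.rpow_add ha0]
      congr 1; push_cast; ring
    have e2 : (a ^ (-(1 / q))) ^ (2 - q) = a ^ (1 - 2 / q) := by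
      rw [← Real.rpow_mul ha0.le]
      congr 1; field_simp; ring
    rw [e2, mul_assoc 4, e1] at this
    linarith
  rcases hα0.eq_or_lt with h0 | h0
  · have hpos : 0 < 1 - 2 / q := by
      rw [sub_pos, div_lt_one hq0]; exact hq
    have hlim : Tendsto (fun a : ℝ => (4 + 2 * C * (2 + C)) * a ^ (1 - 2 / q)) (𝓝[>] 0)
        (𝓝 ((4 + 2 * C * (2 + C)) * 0 ^ (1 - 2 / q))) :=
      ((Real.continuousAt_rpow_const 0 _ (Or.inr hpos.le)).tendsto.mono_left
        nhdsWithin_le_nhds).const_mul _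
    rw [← h0]
    refine ge_of_tendsto hlim ?_
    filter_upwards [Ioo_mem_nhdsGT (zero_lt_one' ℝ)] with a ha
    exact key a (h0 ▸ ha.1.le) ha.1 ha.2.le
  · exact key α le_rfl h0 hα1

end Mixing

/-! ### Second moments of time averages -/

section TimeAverage

variable {Ω : Type*} [MeasurableSpace Ω] {μ : Measure Ω}

/-- On each side of `t` the distance to `t` is injective, so every lag occurs at most twice. -/
theorem sum_dist_le {c : ℕ → ℝ} (h0 : ∀ h, 0 ≤ c h) (hc : Summable c) (s : Finset ℕ) (t : ℕ) :
    ∑ k ∈ s, c (Nat.dist t k) ≤ 2 * ∑' h, c h := by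
  classical
  have key : ∀ s' : Finset ℕ, Set.InjOn (Nat.dist t) s' →
      ∑ k ∈ s', c (Nat.dist t k) ≤ ∑' h, c h := fun s' hs' => by
    rw [← Finset.sum_image (f := c) hs']
    exact hc.sum_le_tsum _ fun h _ => h0 h
  rw [← Finset.sum_filter_add_sum_filter_not s (fun k => k ≤ t), two_mul]
  refine add_le_add (key _ fun a ha b hb hab => ?_) (key _ fun a ha b hb hab => ?_)
  · simp only [Finset.coe_filter, Set.mem_ofPred_eq] at ha hb
    simp only [Nat.dist] at hab
    omega
  · simp only [Finset.coe_filter, Set.mem_ofPred_eq] at ha hb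
    simp only [Nat.dist] at hab
    omega

theorem integral_sq_average_le {Z : ℕ → Ω → ℝ} (hZ : ∀ t, MemLp (Z t) 2 μ) {c : ℕ → ℝ}
    (h0 : ∀ h, 0 ≤ c h) (hc : Summable c)
    (hcov : ∀ s t, ∫ ω, Z s ω * Z t ω ∂μ ≤ c (Nat.dist s t)) {T : ℕ} (hT : 0 < T) :
    ∫ ω, ((T : ℝ)⁻¹ * ∑ t ∈ Finset.Icc 1 T, Z t ω) ^ 2 ∂μ ≤ 2 * (∑' h, c h) / T := by
  have hbound : ∀ s t, Integrable (fun ω => Z s ω * Z t ω) μ := fun s t =>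
    (hZ s).integrable_mul (hZ t)
  have e : ∀ ω, ((T : ℝ)⁻¹ * ∑ t ∈ Finset.Icc 1 T, Z t ω) ^ 2 =
      ((T : ℝ)⁻¹) ^ 2 * ∑ s ∈ Finset.Icc 1 T, ∑ t ∈ Finset.Icc 1 T, Z s ω * Z t ω := fun ω => by
    rw [mul_pow, sq (∑ t ∈ Finset.Icc 1 T, Z t ω), Finset.sum_mul_sum]
  simp only [e]
  rw [integral_const_mul,
    integral_finsetSum _ fun s _ => integrable_finsetSum _ fun t _ => hbound s t]
  have h1 : ∑ s ∈ Finset.Icc 1 T, ∫ ω, ∑ t ∈ Finset.Icc 1 T, Z s ω * Z t ω ∂μ ≤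
      T * (2 * ∑' h, c h) := by
    calc _ ≤ ∑ _s ∈ Finset.Icc 1 T, 2 * ∑' h, c h := Finset.sum_le_sum fun s _ => by
          rw [integral_finsetSum _ fun t _ => hbound s t]
          exact (Finset.sum_le_sum fun t _ => hcov s t).trans (sum_dist_le h0 hc _ _)
      _ = _ := by simp
  have hT' : (0 : ℝ) < T := by exact_mod_cast hT
  calc _ ≤ ((T : ℝ)⁻¹) ^ 2 * (T * (2 * ∑' h, c h)) := mul_le_mul_of_nonneg_left h1 (by positivity)
    _ = _ := by field_simp

theorem integral_sq_average_le_of_orthogonal {Z : ℕ → Ω → ℝ} (hZ : ∀ t, MemLp (Z t) 2 μ) {K : ℝ}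
    (hK : 0 ≤ K) (hvar : ∀ t, ∫ ω, Z t ω ^ 2 ∂μ ≤ K)
    (hcov : ∀ s t, s ≠ t → ∫ ω, Z s ω * Z t ω ∂μ = 0) {T : ℕ} (hT : 0 < T) :
    ∫ ω, ((T : ℝ)⁻¹ * ∑ t ∈ Finset.Icc 1 T, Z t ω) ^ 2 ∂μ ≤ 2 * K / T := by
  have hsum : HasSum (fun h : ℕ => if h = 0 then K else 0) K := hasSum_ite_eq 0 K
  -- Orthogonality is the case of a covariance bound supported at lag zero.
  have := integral_sq_average_le hZ (c := fun h => if h = 0 then K else 0)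
    (fun h => by split_ifs <;> simp [hK]) hsum.summable (fun s t => ?_) hT
  · rwa [hsum.tsum_eq] at this
  · by_cases hst : s = t
    · subst hst
      simpa [sq] using hvar s
    · simp [hcov s t hst, Nat.dist]
      split_ifs <;> simp [hK]

end TimeAverage

/-! ### Moments of the factor process -/

theorem sq_le_one_add_rpow {q : ℝ} (hq : 2 ≤ q) (x : ℝ) : x ^ 2 ≤ 1 + |x| ^ q := by
  have h0 : 0 ≤ |x| ^ q := by positivity
  rcases le_total |x| 1 with h | h
  · nlinarith [sq_abs x, abs_nonneg x]
  · have := Real.rpow_le_rpow_of_exponent_le h hq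
    rw [Real.rpow_two, sq_abs] at this
    linarith

/-- Since `|xy|` is at most the larger of the two squares, moments of order `2q` of the factor give
moments of order `q` of its products, as Davydov's inequality requires. -/
theorem abs_mul_rpow_le {q : ℝ} (hq : 0 ≤ q) (x y : ℝ) :
    |x * y| ^ q ≤ |x| ^ (2 * q) + |y| ^ (2 * q) := by
  have hx : |x| ^ (2 * q) = (|x| ^ 2) ^ q := by
    rw [Real.rpow_mul (abs_nonneg x), Real.rpow_two]
  have hy : |y| ^ (2 * q) = (|y| ^ 2) ^ q := by
    rw [Real.rpow_mul (abs_nonneg y), Real.rpow_two]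
  have h1 : 0 ≤ (|x| ^ 2) ^ q := by positivity
  have h2 : 0 ≤ (|y| ^ 2) ^ q := by positivity
  rw [hx, hy, abs_mul]
  rcases le_total |x| |y| with h | h
  · have : (|x| * |y|) ^ q ≤ (|y| ^ 2) ^ q :=
      Real.rpow_le_rpow (by positivity) (by nlinarith [abs_nonneg x, abs_nonneg y]) hq
    linarith
  · have : (|x| * |y|) ^ q ≤ (|x| ^ 2) ^ q :=
      Real.rpow_le_rpow (by positivity) (by nlinarith [abs_nonneg x, abs_nonneg y]) hq
    linarith

/-! ### Basic properties of the mixing coefficients -/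

section Alpha

variable {Ω : Type*} {d r : ℕ} {X : ℤ → Ω → Matrix (Fin d) (Fin r) ℝ}

theorem measurable_sigmaField {I : Set ℤ} {t : ℤ} (ht : t ∈ I) (k : Fin d × Fin r) :
    Measurable[sigmaField X I] fun ω => X t ω k.1 k.2 := by
  have h1 : Measurable[sigmaField X I] (fun ω (k : Fin d × Fin r) => X t ω k.1 k.2) :=
    Measurable.of_comap_le (le_iSup₂_of_le t ht le_rfl)
  exact (measurable_pi_apply k).comp h1

variable [MeasurableSpace Ω] {μ : Measure Ω}

theorem sigmaField_le (hX : ∀ t i j, Measurable fun ω => X t ω i j) (I : Set ℤ) :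
    sigmaField X I ≤ ‹MeasurableSpace Ω› :=
  iSup₂_le fun t _ => Measurable.comap_le (measurable_pi_lambda _ fun k => hX t k.1 k.2)

theorem alphaMixing_nonneg (h : ℕ) : 0 ≤ alphaMixing μ X h :=
  Real.sSup_nonneg (by rintro x ⟨_, A, B, _, _, rfl⟩; exact abs_nonneg _)

variable [IsProbabilityMeasure μ]

theorem abs_measureReal_inter_sub_le_one (A B : Set Ω) :
    |μ.real (A ∩ B) - μ.real A * μ.real B| ≤ 1 := by
  have h1 := measureReal_nonneg (μ := μ) (s := A ∩ B)
  have h2 := measureReal_nonneg (μ := μ) (s := A)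
  have h3 := measureReal_nonneg (μ := μ) (s := B)
  have h4 := measureReal_le_one (μ := μ) (s := A ∩ B)
  have h5 := measureReal_le_one (μ := μ) (s := A)
  have h6 := measureReal_le_one (μ := μ) (s := B)
  rw [abs_le]
  constructor <;> nlinarith

theorem le_alphaMixing {τ : ℤ} {h : ℕ} {A B : Set Ω}
    (hA : MeasurableSet[sigmaField X (Set.Iic τ)] A)
    (hB : MeasurableSet[sigmaField X (Set.Ici (τ + h))] B) :
    |μ.real (A ∩ B) - μ.real A * μ.real B| ≤ alphaMixing μ X h :=
  le_csSup ⟨1, by rintro x ⟨_, A, B, _, _, rfl⟩; exact abs_measureReal_inter_sub_le_one A B⟩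
    ⟨τ, A, B, hA, hB, rfl⟩

theorem alphaMixing_le_one (h : ℕ) : alphaMixing μ X h ≤ 1 :=
  Real.sSup_le (by rintro x ⟨_, A, B, _, _, rfl⟩; exact abs_measureReal_inter_sub_le_one A B)
    zero_le_one

end Alpha

namespace Model

variable {Ω : Type*} [MeasurableSpace Ω] {μ : Measure Ω} {d r : ℕ}
  {𝒮 : Set (EuclideanSpace ℝ (Fin 2))} {m : Model Ω d r 𝒮} {q : ℝ}

/-- The second moment matrix `E[vec(X_t) vec(X_t)ᵀ]` at `t = 0`. -/
def factorCov (m : Model Ω d r 𝒮) (μ : Measure Ω) :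
    Matrix (Fin d × Fin r) (Fin d × Fin r) ℝ :=
  Matrix.of fun k l => ∫ ω, m.X 0 ω k.1 k.2 * m.X 0 ω l.1 l.2 ∂μ

theorem integral_factor_mul (hmix : m.MixingCondition μ q) (t : ℤ) (k l : Fin d × Fin r) :
    ∫ ω, m.X t ω k.1 k.2 * m.X t ω l.1 l.2 ∂μ = m.factorCov μ k l := by
  have hmeas : ∀ s : ℤ, Measurable fun ω (t : ℤ) (k : Fin d × Fin r) => m.X (t + s) ω k.1 k.2 :=
    fun s => measurable_pi_lambda _ fun t => measurable_pi_lambda _ fun k => hmix.measurable _ _ _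
  have hφ : Measurable fun x : ℤ → Fin d × Fin r → ℝ => x 0 k * x 0 l := by fun_prop
  have h1 := integral_map (hmeas t).aemeasurable hφ.aestronglyMeasurable (μ := μ)
  have h2 := integral_map (hmeas 0).aemeasurable hφ.aestronglyMeasurable (μ := μ)
  have h3 := hmix.stationary t
  simp only [add_zero] at h2
  rw [h3, h2] at h1
  simpa [factorCov] using h1.symm

theorem integral_noise_mul_noise (hnoise : m.NuggetNoise μ) {N : ℕ} (t : ℤ) {u v : 𝒮}
    (huv : u ≠ v) (i j : Fin (m.p N)) : ∫ ω, m.ε N t ω u i * m.ε N t ω v j ∂μ = 0 := by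
  have := hnoise.uncorrelated N t u v huv i j
  simpa [covariance, hnoise.mean_zero] using this

/-- Averages of products of the noise at different sites. -/
theorem exists_noise_average_bound (hnoise : m.NuggetNoise μ) (hdesign : m.Design) :
    ∃ K : ℝ, 0 ≤ K ∧ ∀ (N : ℕ), ∀ u ∈ m.S₁ N, ∀ v ∈ m.S₂ N,
      ∀ (i j : Fin (m.p N)) (T : ℕ), 0 < T →
      (∀ t : ℤ, MemLp (fun ω => m.ε N t ω u i * m.ε N t ω v j) 2 μ) ∧
      ∫ ω, ((T : ℝ)⁻¹ * ∑ t ∈ Finset.Icc 1 T, m.ε N t ω u i * m.ε N t ω v j) ^ 2 ∂μ ≤ K / T := by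
  obtain ⟨K, -, hK⟩ := hnoise.bounded
  refine ⟨2 * |K|, by positivity, fun N u hu v hv i j T hT => ?_⟩
  have huv : u ≠ v := fun h => Finset.disjoint_left.1 (hdesign.disjoint N) hu (h ▸ hv)
  have hL : ∀ t : ℤ, MemLp (fun ω => m.ε N t ω u i * m.ε N t ω v j) 2 μ := fun t => by
    refine (memLp_two_iff_integrable_sq ((hnoise.measurable N t u i).mul
      (hnoise.measurable N t v j)).aestronglyMeasurable).2 ?_
    refine (hK N t u hu v hv i j).1.congr (ae_of_all _ fun ω => ?_)
    simp only [Pi.mul_apply, mul_pow]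
  refine ⟨hL, integral_sq_average_le_of_orthogonal (fun t => hL t) (by positivity)
    (fun t => ?_) (fun s t hst => ?_) hT⟩
  · simpa only [mul_pow] using (hK N t u hu v hv i j).2.trans (le_abs_self K)
  · have hst' : (s : ℤ) ≠ t := by exact_mod_cast hst
    have hi : IndepFun (fun ω => m.ε N s ω u i * m.ε N s ω v j)
        (fun ω => m.ε N t ω u i * m.ε N t ω v j) μ :=
      ((hnoise.indep_time N).indepFun hst').comp
        (φ := fun x : 𝒮 × Fin (m.p N) → ℝ => x (u, i) * x (v, j))
        (ψ := fun x : 𝒮 × Fin (m.p N) → ℝ => x (u, i) * x (v, j)) (by fun_prop) (by fun_prop)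
    rw [hi.integral_fun_mul_eq_mul_integral (hL s).aestronglyMeasurable
      (hL t).aestronglyMeasurable, integral_noise_mul_noise hnoise _ huv, zero_mul]

variable [IsProbabilityMeasure μ]

/-- Uniform integrability facts on the factor process and its products. -/
theorem exists_factor_moments (hmix : m.MixingCondition μ q) (hmom : m.MomentRankCondition μ q) :
    ∃ C : ℝ, 0 ≤ C ∧
      (∀ t (k : Fin d × Fin r), MemLp (fun ω => m.X t ω k.1 k.2) 2 μ ∧
        ∫ ω, m.X t ω k.1 k.2 ^ 2 ∂μ ≤ C) ∧
      (∀ t (k l : Fin d × Fin r),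
        MemLp (fun ω => m.X t ω k.1 k.2 * m.X t ω l.1 l.2) 2 μ ∧
        ∫ ω, (m.X t ω k.1 k.2 * m.X t ω l.1 l.2) ^ 2 ∂μ ≤ C ∧
        Integrable (fun ω => |m.X t ω k.1 k.2 * m.X t ω l.1 l.2| ^ q) μ ∧
        ∫ ω, |m.X t ω k.1 k.2 * m.X t ω l.1 l.2| ^ q ∂μ ≤ C) := by
  obtain ⟨C, hC, hX⟩ := hmom.moments
  have hq := hmix.two_lt
  have hlift : ∀ (U : Ω → ℝ) (p c : ℝ), Measurable U → 2 ≤ p →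
      Integrable (fun ω => |U ω| ^ p) μ → ∫ ω, |U ω| ^ p ∂μ ≤ c →
      MemLp U 2 μ ∧ ∫ ω, U ω ^ 2 ∂μ ≤ 1 + c := fun U p c hU hp hi hc => by
    have hdom : Integrable (fun ω => 1 + |U ω| ^ p) μ := (integrable_const 1).add hi
    have hsq : Integrable (fun ω => U ω ^ 2) μ :=
      hdom.mono' (hU.pow_const 2).aestronglyMeasurable (ae_of_all _ fun ω => by
        rw [Real.norm_of_nonneg (sq_nonneg _)]; exact sq_le_one_add_rpow hp _)
    refine ⟨(memLp_two_iff_integrable_sq hU.aestronglyMeasurable).2 hsq, ?_⟩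
    calc _ ≤ ∫ ω, (1 + |U ω| ^ p) ∂μ :=
          integral_mono hsq hdom fun ω => sq_le_one_add_rpow hp _
      _ = 1 + ∫ ω, |U ω| ^ p ∂μ := by rw [integral_add (integrable_const 1) hi]; simp
      _ ≤ _ := by linarith
  refine ⟨1 + 2 * C, by positivity, fun t k => ?_, fun t k l => ?_⟩
  · have := hlift _ (2 * q) C (hmix.measurable t k.1 k.2) (by linarith) (hX t k.1 k.2).1
      (hX t k.1 k.2).2
    exact ⟨this.1, by linarith [this.2]⟩
  · have hm : Measurable fun ω => m.X t ω k.1 k.2 * m.X t ω l.1 l.2 :=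
      (hmix.measurable t k.1 k.2).mul (hmix.measurable t l.1 l.2)
    have hdom := (hX t k.1 k.2).1.add (hX t l.1 l.2).1
    have hi : Integrable (fun ω => |m.X t ω k.1 k.2 * m.X t ω l.1 l.2| ^ q) μ := by
      refine hdom.mono' (hm.abs.pow_const q).aestronglyMeasurable (ae_of_all _ fun ω => ?_)
      rw [Real.norm_of_nonneg (by positivity)]
      exact abs_mul_rpow_le (by linarith) _ _
    have hle : ∫ ω, |m.X t ω k.1 k.2 * m.X t ω l.1 l.2| ^ q ∂μ ≤ 2 * C := by
      calc _ ≤ ∫ ω, (|m.X t ω k.1 k.2| ^ (2 * q) + |m.X t ω l.1 l.2| ^ (2 * q)) ∂μ :=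
            integral_mono hi hdom fun ω => abs_mul_rpow_le (by linarith) _ _
        _ = _ := integral_add (hX t k.1 k.2).1 (hX t l.1 l.2).1
        _ ≤ _ := by linarith [(hX t k.1 k.2).2, (hX t l.1 l.2).2]
    have := hlift _ q (2 * C) hm hq.le hi hle
    exact ⟨this.1, this.2, hi, by linarith⟩

/-- The sample second moments of the factor converge at rate `T^{-1/2}` in mean square. -/
theorem exists_factor_average_bound (hmix : m.MixingCondition μ q)
    (hmom : m.MomentRankCondition μ q) :
    ∃ K : ℝ, 0 ≤ K ∧ ∀ (k l : Fin d × Fin r) (T : ℕ), 0 < T →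
      ∫ ω, ((T : ℝ)⁻¹ * ∑ t ∈ Finset.Icc 1 T,
        (m.X t ω k.1 k.2 * m.X t ω l.1 l.2 - m.factorCov μ k l)) ^ 2 ∂μ ≤ K / T := by
  obtain ⟨C, hC, -, hprod⟩ := exists_factor_moments hmix hmom
  set α := fun h => alphaMixing μ m.X h ^ (1 - 2 / q) with hαdef
  have hα0 : ∀ h, 0 ≤ α h := fun h => Real.rpow_nonneg (alphaMixing_nonneg h) _
  set D := 4 + 2 * C * (2 + C) with hD
  have hD0 : 0 ≤ D := by positivity
  -- Lag zero is bounded by the second moment, positive lags by the covariance inequality. Shifting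
  -- the index by one matches the mixing hypothesis, which starts at `α(1)`.
  set c : ℕ → ℝ := fun h => if h = 0 then C else D * α h with hcdef
  have hc0 : ∀ h, 0 ≤ c h := fun h => by
    simp only [hcdef]; split_ifs; exacts [hC, mul_nonneg hD0 (hα0 h)]
  have hcs : Summable c := by
    rw [← summable_nat_add_iff 1]
    simpa [hcdef] using hmix.mixing.mul_left D
  refine ⟨2 * ∑' h, c h, mul_nonneg two_pos.le (tsum_nonneg hc0), fun k l T hT => ?_⟩
  set U : ℤ → Ω → ℝ := fun t ω => m.X t ω k.1 k.2 * m.X t ω l.1 l.2 with hU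
  have hUL : ∀ t, MemLp (U t) 2 μ := fun t => (hprod t k l).1
  have hUi : ∀ t, Integrable (U t) μ := fun t => (hUL t).integrable (by norm_num)
  have hmean : ∀ t, ∫ ω, U t ω ∂μ = m.factorCov μ k l := fun t => integral_factor_mul hmix t k l
  set e := m.factorCov μ k l
  have hexp : ∀ s t : ℤ, ∫ ω, (U s ω - e) * (U t ω - e) ∂μ =
      ∫ ω, U s ω * U t ω ∂μ - (∫ ω, U s ω ∂μ) * ∫ ω, U t ω ∂μ := fun s t => by
    have := covariance_eq_sub (hUL s) (hUL t)
    simpa [covariance, hmean] using this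
  have hord : ∀ s t : ℕ, s ≤ t →
      ∫ ω, (U s ω - e) * (U t ω - e) ∂μ ≤ c (Nat.dist s t) := fun s t hst => by
    rw [hexp]
    rcases hst.eq_or_lt with rfl | hlt
    · simp only [Nat.dist_self, hcdef, if_true]
      have h1 := (hprod s k l).2.1
      have h2 : ∫ ω, U s ω * U s ω ∂μ = ∫ ω, (m.X s ω k.1 k.2 * m.X s ω l.1 l.2) ^ 2 ∂μ := by
        simp only [sq, hU]
      rw [h2]
      nlinarith [mul_self_nonneg (∫ ω, U s ω ∂μ)]
    · rw [Nat.dist_eq_sub_of_le hst]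
      simp only [hcdef, if_neg (Nat.sub_ne_zero_of_lt hlt)]
      refine (le_abs_self _).trans ?_
      have hmem : (t : ℤ) ∈ Set.Ici ((s : ℤ) + ((t - s : ℕ) : ℤ)) := by
        simp only [Set.mem_Ici]; omega
      exact abs_covariance_le_rpow (sigmaField_le hmix.measurable (Set.Iic (s : ℤ)))
        (sigmaField_le hmix.measurable (Set.Ici ((s : ℤ) + ((t - s : ℕ) : ℤ))))
        (fun A B hA hB => le_alphaMixing hA hB) (alphaMixing_le_one _)
        ((measurable_sigmaField (Set.mem_Iic.2 le_rfl) k).mul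
          (measurable_sigmaField (Set.mem_Iic.2 le_rfl) l))
        ((measurable_sigmaField hmem k).mul (measurable_sigmaField hmem l))
        hmix.two_lt (hprod s k l).2.2.1 (hprod t k l).2.2.1 (hprod s k l).2.2.2
        (hprod t k l).2.2.2 (hUi s) (hUi t) ((hUL s).integrable_mul (hUL t))
  refine integral_sq_average_le (Z := fun t ω => U t ω - e) (fun t => (hUL t).sub (memLp_const e))
    hc0 hcs (fun s t => ?_) hT
  rcases le_total s t with h | h
  · exact hord s t h
  · have := hord t s h
    rw [Nat.dist_comm]
    simpa only [mul_comm] using this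

/-! ### Averages involving the noise -/

/-- Averages of products of factor and noise. -/
theorem exists_factor_noise_average_bound (hmix : m.MixingCondition μ q)
    (hmom : m.MomentRankCondition μ q) (hnoise : m.NuggetNoise μ) :
    ∃ K : ℝ, 0 ≤ K ∧ ∀ (N : ℕ) (k : Fin d × Fin r), ∀ u ∈ (m.S₁ N : Set 𝒮) ∪ m.S₂ N,
      ∀ (i : Fin (m.p N)) (T : ℕ), 0 < T →
      (∀ t : ℤ, MemLp (fun ω => m.X t ω k.1 k.2 * m.ε N t ω u i) 2 μ) ∧
      ∫ ω, ((T : ℝ)⁻¹ * ∑ t ∈ Finset.Icc 1 T, m.X t ω k.1 k.2 * m.ε N t ω u i) ^ 2 ∂μ ≤ K / T := by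
  obtain ⟨C, hC, hfac, -⟩ := exists_factor_moments hmix hmom
  obtain ⟨K, hK, -⟩ := hnoise.bounded
  refine ⟨2 * (C * |K|), by positivity, fun N k u hu i T hT => ?_⟩
  -- The covariance at times `s`, `t` factors into a factor part and a noise part. The latter
  -- vanishes for `s ≠ t`, so the dependence of the factor over time plays no role.
  have hind : ∀ s t : ℤ, IndepFun (fun ω => m.X s ω k.1 k.2 * m.X t ω k.1 k.2)
      (fun ω => m.ε N s ω u i * m.ε N t ω u i) μ := fun s t =>
    (hnoise.indep_factor N).comp
      (φ := fun x : ℤ → Fin d × Fin r → ℝ => x s k * x t k)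
      (ψ := fun x : ℤ → 𝒮 × Fin (m.p N) → ℝ => x s (u, i) * x t (u, i))
      (by fun_prop) (by fun_prop)
  have hXX : ∀ s t : ℤ, Integrable (fun ω => m.X s ω k.1 k.2 * m.X t ω k.1 k.2) μ := fun s t =>
    (hfac s k).1.integrable_mul (hfac t k).1
  have hee : ∀ s t : ℤ, Integrable (fun ω => m.ε N s ω u i * m.ε N t ω u i) μ := fun s t =>
    (hnoise.memLp N s u i).integrable_mul (hnoise.memLp N t u i)
  have hre : ∀ (s t : ℤ) ω, (m.X s ω k.1 k.2 * m.ε N s ω u i) * (m.X t ω k.1 k.2 * m.ε N t ω u i) =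
      (m.X s ω k.1 k.2 * m.X t ω k.1 k.2) * (m.ε N s ω u i * m.ε N t ω u i) := fun s t ω => by ring
  have hL : ∀ t : ℤ, MemLp (fun ω => m.X t ω k.1 k.2 * m.ε N t ω u i) 2 μ := fun t => by
    refine (memLp_two_iff_integrable_sq ((hmix.measurable t k.1 k.2).mul
      (hnoise.measurable N t u i)).aestronglyMeasurable).2 ?_
    have := (hind t t).integrable_mul (hXX t t) (hee t t)
    refine this.congr (ae_of_all _ fun ω => ?_)
    simp only [Pi.mul_apply]; ring
  have hmul : ∀ s t : ℤ, ∫ ω, (m.X s ω k.1 k.2 * m.ε N s ω u i) *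
      (m.X t ω k.1 k.2 * m.ε N t ω u i) ∂μ =
      (∫ ω, m.X s ω k.1 k.2 * m.X t ω k.1 k.2 ∂μ) * ∫ ω, m.ε N s ω u i * m.ε N t ω u i ∂μ :=
    fun s t => by
      simp only [hre]
      exact (hind s t).integral_fun_mul_eq_mul_integral (hXX s t).aestronglyMeasurable
        (hee s t).aestronglyMeasurable
  refine ⟨hL, integral_sq_average_le_of_orthogonal (fun t => hL t) (by positivity)
    (fun t => ?_) (fun s t hst => ?_) hT⟩
  · have := hmul t t
    simp only [← sq] at this
    rw [this]
    exact mul_le_mul (hfac t k).2 ((hK N t u hu i).trans (le_abs_self K))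
      (integral_nonneg fun _ => sq_nonneg _) hC
  · have hst' : (s : ℤ) ≠ t := by exact_mod_cast hst
    have h0 : ∫ ω, m.ε N s ω u i * m.ε N t ω u i ∂μ = 0 := by
      have hi : IndepFun (fun ω => m.ε N s ω u i) (fun ω => m.ε N t ω u i) μ :=
        ((hnoise.indep_time N).indepFun hst').comp
          (φ := fun x : 𝒮 × Fin (m.p N) → ℝ => x (u, i))
          (ψ := fun x : 𝒮 × Fin (m.p N) → ℝ => x (u, i)) (by fun_prop) (by fun_prop)
      rw [hi.integral_fun_mul_eq_mul_integral
        (hnoise.measurable N s u i).aestronglyMeasurable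
        (hnoise.measurable N t u i).aestronglyMeasurable, hnoise.mean_zero, zero_mul]
    rw [hmul, h0, mul_zero]

end Model

/-! ### Kronecker structure of the loadings -/

section Kronecker

open scoped Kronecker

variable {ι κ η θ : Type*} [Fintype ι] [Fintype κ] [Fintype η] [Fintype θ]

theorem frobSq_kronecker (A : Matrix ι κ ℝ) (B : Matrix η θ ℝ) :
    frobSq (A ⊗ₖ B) = frobSq A * frobSq B := by
  simp only [frobSq, Fintype.sum_prod_type, Matrix.kroneckerMap_apply, mul_pow]
  rw [Finset.sum_mul_sum]
  refine Finset.sum_congr rfl fun i _ => Finset.sum_congr rfl fun j _ => ?_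
  rw [Finset.sum_mul_sum]

theorem frobSq_add_le (A B : Matrix ι κ ℝ) : frobSq (A + B) ≤ 2 * (frobSq A + frobSq B) := by
  simp only [frobSq, ← Finset.sum_add_distrib, Finset.mul_sum]
  refine Finset.sum_le_sum fun i _ => Finset.sum_le_sum fun j _ => ?_
  rw [Matrix.add_apply]
  nlinarith [sq_nonneg (A i j - B i j)]

/-- `A` expands squared Euclidean norms by at least the factor `a`. -/
def ExpandsBy (A : Matrix ι κ ℝ) (a : ℝ) : Prop :=
  ∀ v, a * (v ⬝ᵥ v) ≤ (A *ᵥ v) ⬝ᵥ (A *ᵥ v)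

theorem ExpandsBy.frobSq_mul {A : Matrix ι κ ℝ} {a : ℝ} (h : ExpandsBy A a) (H : Matrix κ η ℝ) :
    a * frobSq H ≤ frobSq (A * H) := by
  rw [← frobSq_transpose, ← frobSq_transpose (A * H), frobSq, frobSq, Finset.mul_sum]
  refine Finset.sum_le_sum fun k _ => ?_
  simpa [dotProduct, sq, Matrix.mul_apply, Matrix.mulVec] using h (Hᵀ k)

theorem ExpandsBy.frobSq_mul_transpose {A : Matrix ι κ ℝ} {a : ℝ} (h : ExpandsBy A a)
    (H : Matrix η κ ℝ) : a * frobSq H ≤ frobSq (H * Aᵀ) := by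
  have := h.frobSq_mul Hᵀ
  rwa [frobSq_transpose, ← frobSq_transpose (A * Hᵀ), Matrix.transpose_mul,
    Matrix.transpose_transpose] at this

/-- Reshaping the vector into a matrix `V` turns the Kronecker product into `V ↦ A V B'`, to which
the two expansions apply in turn. -/
theorem ExpandsBy.kronecker {A : Matrix ι κ ℝ} {B : Matrix η θ ℝ} {a b : ℝ} (hA : ExpandsBy A a)
    (hB : ExpandsBy B b) (ha : 0 ≤ a) : ExpandsBy (A ⊗ₖ B) (a * b) := fun v => by
  let V : Matrix κ θ ℝ := Matrix.of fun k l => v (k, l)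
  have h1 : v ⬝ᵥ v = frobSq V := by
    simp [dotProduct, frobSq, Fintype.sum_prod_type, V, sq]
  have h2 : ((A ⊗ₖ B) *ᵥ v) ⬝ᵥ ((A ⊗ₖ B) *ᵥ v) = frobSq (A * (V * Bᵀ)) := by
    simp only [dotProduct, frobSq, Fintype.sum_prod_type, sq]
    refine Finset.sum_congr rfl fun i _ => Finset.sum_congr rfl fun j _ => ?_
    have : ((A ⊗ₖ B) *ᵥ v) (i, j) = (A * (V * Bᵀ)) i j := by
      simp only [Matrix.mulVec, dotProduct, Fintype.sum_prod_type, Matrix.mul_apply, V,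
        Matrix.kroneckerMap_apply, Matrix.of_apply, Matrix.transpose_apply, Finset.mul_sum]
      exact Finset.sum_congr rfl fun k _ => Finset.sum_congr rfl fun l _ => by ring
    rw [this]
  rw [h1, h2, mul_assoc]
  exact (mul_le_mul_of_nonneg_left (hB.frobSq_mul_transpose V) ha).trans (hA.frobSq_mul _)

theorem exists_expandsBy_of_injective (A : Matrix ι κ ℝ) (hA : ∀ x, A *ᵥ x = 0 → x = 0) :
    ∃ a, 0 < a ∧ ExpandsBy A a := by
  classical
  set R := (Aᵀ * A)⁻¹ * Aᵀ
  have hR : R * A = 1 := by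
    rw [Matrix.mul_assoc, Matrix.nonsing_inv_mul _ (isUnit_det_transpose_mul A hA)]
  have h0 := frobSq_nonneg R
  -- `R` is a left inverse, so `‖v‖² ≤ ‖R‖_F² ‖A v‖²`; adding one keeps the constant positive when
  -- `R = 0`.
  refine ⟨(frobSq R + 1)⁻¹, by positivity, fun v => ?_⟩
  have h1 := mulVec_dotProduct_self_le R (A *ᵥ v)
  rw [Matrix.mulVec_mulVec, hR, Matrix.one_mulVec] at h1
  have h2 := dotProduct_self_nonneg (A *ᵥ v)
  rw [inv_mul_le_iff₀ (by positivity)]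
  linarith

theorem ExpandsBy.injective {A : Matrix ι κ ℝ} {a : ℝ} (h : ExpandsBy A a) (ha : 0 < a) :
    ∀ x, A *ᵥ x = 0 → x = 0 := fun x hx => by
  have h1 := h x
  rw [hx, dotProduct_zero] at h1
  have h2 := dotProduct_self_nonneg x
  exact dotProduct_self_eq_zero.1 (le_antisymm (by nlinarith) h2)

/-- With `z = A'Ax` one has `‖Ax‖² = x · z`. Cauchy–Schwarz and `a‖x‖² ≤ x · z` give `a (x · z) ≤
‖z‖²`. -/
theorem ExpandsBy.transpose_on_range {A : Matrix ι κ ℝ} {a : ℝ} (h : ExpandsBy A a) (ha : 0 < a)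
    (x : κ → ℝ) :
    a * ((A *ᵥ x) ⬝ᵥ (A *ᵥ x)) ≤ (Aᵀ *ᵥ (A *ᵥ x)) ⬝ᵥ (Aᵀ *ᵥ (A *ᵥ x)) := by
  set z := Aᵀ *ᵥ (A *ᵥ x)
  have h1 : (A *ᵥ x) ⬝ᵥ (A *ᵥ x) = x ⬝ᵥ z := by
    rw [← dotProduct_transpose_mul_mulVec, ← Matrix.mulVec_mulVec]
  have h2 := dotProduct_sq_le x z
  have h3 := h x
  rw [h1] at h3 ⊢
  have h4 := dotProduct_self_nonneg x
  have h5 := dotProduct_self_nonneg z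
  rcases h4.eq_or_lt with h6 | h6
  · rw [← h6] at h2
    have : x ⬝ᵥ z = 0 := by nlinarith
    rw [this]; simpa using h5
  · have h7 : 0 < x ⬝ᵥ z := lt_of_lt_of_le (by positivity) h3
    refine le_of_mul_le_mul_left ?_ h6
    nlinarith

/-- Move a factor of the row index to the columns. -/
def unfoldRows (M : Matrix (ι × η) θ ℝ) : Matrix ι (η × θ) ℝ :=
  Matrix.of fun u x => M (u, x.1) x.2

theorem frobSq_unfoldRows (M : Matrix (ι × η) θ ℝ) : frobSq (unfoldRows M) = frobSq M := by
  simp [frobSq, unfoldRows, Fintype.sum_prod_type]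

/-- The matrix `G` with `unfoldRows ((A ⊗ B) Z) = A G`. -/
def contractRows (B : Matrix η κ ℝ) (Z : Matrix (ι × κ) θ ℝ) : Matrix ι (η × θ) ℝ :=
  Matrix.of fun a x => ∑ k, B x.1 k * Z (a, k) x.2

theorem unfoldRows_kronecker_mul {ζ ξ τ : Type*} (A : Matrix ζ ι ℝ) (B : Matrix ξ κ ℝ)
    (Z : Matrix (ι × κ) τ ℝ) : unfoldRows ((A ⊗ₖ B) * Z) = A * contractRows B Z := by
  ext u x
  simp only [unfoldRows, contractRows, Matrix.of_apply, Matrix.mul_apply, Fintype.sum_prod_type,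
    Matrix.kroneckerMap_apply, Finset.mul_sum]
  exact Finset.sum_congr rfl fun a _ => Finset.sum_congr rfl fun k _ => by ring

/-- Contraction of the first row index of `C` with a vector. -/
def contractVec (C : Matrix (ι × κ) η ℝ) (z : ι → ℝ) : Matrix κ η ℝ :=
  Matrix.of fun k y => ((unfoldRows C)ᵀ *ᵥ z) (k, y)

theorem frobSq_contractVec (C : Matrix (ι × κ) η ℝ) (z : ι → ℝ) :
    frobSq (contractVec C z) = ((unfoldRows C)ᵀ *ᵥ z) ⬝ᵥ ((unfoldRows C)ᵀ *ᵥ z) := by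
  simp [frobSq, contractVec, dotProduct, Fintype.sum_prod_type, sq]

/-- Contracting the first row index commutes with multiplication by `B` and `L`, which act on the
other indices. Thus `G'z`, read as a matrix, is a product whose factors can be bounded separately.
-/
theorem contractRows_transpose_mulVec {ζ τ : Type*} (B : Matrix ζ κ ℝ)
    (C : Matrix (ι × κ) η ℝ) (L : Matrix τ η ℝ) (z : ι → ℝ) (x : ζ × τ) :
    ((contractRows B (C * Lᵀ))ᵀ *ᵥ z) x = (B * (contractVec C z * Lᵀ)) x.1 x.2 := by
  simp only [Matrix.mulVec, dotProduct, contractRows, contractVec, unfoldRows, Matrix.of_apply,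
    Matrix.transpose_apply, Matrix.mul_apply, Finset.mul_sum, Finset.sum_mul]
  rw [Finset.sum_comm]
  refine Finset.sum_congr rfl fun k _ => ?_
  rw [Finset.sum_comm]
  exact Finset.sum_congr rfl fun y _ => Finset.sum_congr rfl fun a _ => by ring

theorem contractRows_transpose_mulVec_dotProduct {ζ : Type*} [Fintype ζ] (B : Matrix ζ κ ℝ)
    (C : Matrix (ι × κ) η ℝ) (L : Matrix θ η ℝ) (z : ι → ℝ) :
    ((contractRows B (C * Lᵀ))ᵀ *ᵥ z) ⬝ᵥ ((contractRows B (C * Lᵀ))ᵀ *ᵥ z) =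
      frobSq (B * (contractVec C z * Lᵀ)) := by
  simp only [dotProduct, frobSq, contractRows_transpose_mulVec, sq, Fintype.sum_prod_type]

/-- The signal strength of a cross-covariance `(A ⊗ B) C Lᵀ`. -/
theorem signal_lower_bound {ζ ξ : Type*} [Fintype ζ] [Fintype ξ] {A : Matrix ξ ι ℝ}
    {B : Matrix ζ κ ℝ} {C : Matrix (ι × κ) η ℝ} {L : Matrix θ η ℝ} {a b c l : ℝ}
    (hA : ExpandsBy A a) (hB : ExpandsBy B b) (hC : ExpandsBy (unfoldRows C)ᵀ c)
    (hL : ExpandsBy L l) (ha : 0 < a) (hb : 0 ≤ b) (hc : 0 ≤ c) (hl : 0 ≤ l) (x : ι → ℝ) :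
    (b * l * c * a) * ((A *ᵥ x) ⬝ᵥ (A *ᵥ x)) ≤
      ((unfoldRows ((A ⊗ₖ B) * (C * Lᵀ)))ᵀ *ᵥ (A *ᵥ x)) ⬝ᵥ
        ((unfoldRows ((A ⊗ₖ B) * (C * Lᵀ)))ᵀ *ᵥ (A *ᵥ x)) := by
  rw [unfoldRows_kronecker_mul, Matrix.transpose_mul, ← Matrix.mulVec_mulVec,
    contractRows_transpose_mulVec_dotProduct]
  set z := Aᵀ *ᵥ (A *ᵥ x)
  calc (b * l * c * a) * ((A *ᵥ x) ⬝ᵥ (A *ᵥ x))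
      = b * (l * (c * (a * ((A *ᵥ x) ⬝ᵥ (A *ᵥ x))))) := by ring
    _ ≤ b * (l * (c * (z ⬝ᵥ z))) := by
        gcongr; exact hA.transpose_on_range ha x
    _ ≤ b * (l * frobSq (contractVec C z)) := by
        rw [frobSq_contractVec]; gcongr; exact hC z
    _ ≤ b * frobSq (contractVec C z * Lᵀ) := by
        gcongr; exact hL.frobSq_mul_transpose _
    _ ≤ _ := hB.frobSq_mul _

/-- If the Gram matrix of the unfolding of `(A ⊗ B) C Lᵀ` has full rank, the unfolding of `C` has
full row rank. -/
theorem unfoldRows_transpose_injective_of_rank {d : ℕ} {ζ ξ : Type*} [Fintype ζ] [Fintype ξ]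
    {A : Matrix ξ (Fin d) ℝ} {B : Matrix ζ κ ℝ} {C : Matrix (Fin d × κ) η ℝ} {L : Matrix θ η ℝ}
    (h : (unfoldRows ((A ⊗ₖ B) * (C * Lᵀ)) * (unfoldRows ((A ⊗ₖ B) * (C * Lᵀ)))ᵀ).rank = d) :
    ∀ z, (unfoldRows C)ᵀ *ᵥ z = 0 → z = 0 := fun z hz => by
  classical
  rw [Matrix.rank_self_mul_transpose, unfoldRows_kronecker_mul] at h
  set G := contractRows B (C * Lᵀ)
  -- The rank of `A G` does not exceed that of `G`, so `G` has full row rank; a vector killed by the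
  -- unfolding of `C` would also be killed by `G'`.
  have hG : d ≤ Gᵀ.rank := by
    rw [Matrix.rank_transpose]; exact h.ge.trans (Matrix.rank_mul_le_right A G)
  have hker : LinearMap.ker Gᵀ.mulVecLin = ⊥ := by
    have := LinearMap.finrank_range_add_finrank_ker Gᵀ.mulVecLin
    rw [Module.finrank_fin_fun] at this
    have h2 : Module.finrank ℝ (LinearMap.range Gᵀ.mulVecLin) = Gᵀ.rank := rfl
    exact Submodule.finrank_eq_zero.1 (by omega)
  have hGz : Gᵀ *ᵥ z = 0 := by
    have h0 : contractVec C z = 0 := by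
      ext k y; simp [contractVec, hz]
    ext x
    rw [contractRows_transpose_mulVec, h0]; simp
  have : z ∈ LinearMap.ker Gᵀ.mulVecLin := LinearMap.mem_ker.2 hGz
  rwa [hker, Submodule.mem_bot] at this

end Kronecker

/-! ### The cross-space covariance of the model -/

namespace Model

open scoped Kronecker

variable {Ω : Type*} {d r : ℕ} {𝒮 : Set (EuclideanSpace ℝ (Fin 2))} {q : ℝ}

/-- The sample cross-space covariance of all variables. -/
def sampleCross (m : Model Ω d r 𝒮) (N : ℕ) (ω : Ω) :
    Matrix (m.S₁ N × Fin (m.p N)) (m.S₂ N × Fin (m.p N)) ℝ :=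
  Matrix.of fun x y => m.sampleOmega N ω x.2 y.2 x.1 y.1

/-- The population cross-space covariance of all variables. -/
def popCross [MeasurableSpace Ω] (m : Model Ω d r 𝒮) (μ : Measure Ω) (N : ℕ) :
    Matrix (m.S₁ N × Fin (m.p N)) (m.S₂ N × Fin (m.p N)) ℝ :=
  (m.A₁ N ⊗ₖ m.B N) * (m.factorCov μ * (m.A₂ N ⊗ₖ m.B N)ᵀ)

variable {m : Model Ω d r 𝒮}

/-- A sum of Gram matrices is the Gram matrix of the blocks set side by side. This makes the
eigenvector problem one of singular vectors. -/
theorem sum_mul_transpose_eq_unfoldRows {ι κ η : Type*} [Fintype ι] [Fintype κ] [Fintype η]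
    (O : η → η → Matrix ι κ ℝ) :
    ∑ i, ∑ j, O i j * (O i j)ᵀ =
      unfoldRows (Matrix.of fun (x : ι × η) (y : κ × η) => O x.2 y.2 x.1 y.1) *
        (unfoldRows (Matrix.of fun (x : ι × η) (y : κ × η) => O x.2 y.2 x.1 y.1))ᵀ := by
  ext u u'
  simp only [Matrix.sum_apply, Matrix.mul_apply, Matrix.transpose_apply, unfoldRows,
    Matrix.of_apply, Fintype.sum_prod_type]
  exact Finset.sum_congr rfl fun i _ => Finset.sum_comm

theorem sampleM₁_eq (N : ℕ) (ω : Ω) :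
    m.sampleM₁ N ω = unfoldRows (m.sampleCross N ω) * (unfoldRows (m.sampleCross N ω))ᵀ :=
  sum_mul_transpose_eq_unfoldRows (m.sampleOmega N ω)

theorem y_apply (N : ℕ) (t : ℤ) (ω : Ω) (s : 𝒮) (i : Fin (m.p N)) :
    m.y N t ω s i =
      ∑ k : Fin d × Fin r, (m.a s k.1 * m.B N i k.2) * m.X t ω k.1 k.2 + m.ε N t ω s i := by
  simp only [y, Pi.add_apply, Matrix.mulVec, dotProduct, Matrix.mul_apply, Matrix.transpose_apply,
    Finset.sum_mul, Fintype.sum_prod_type]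
  congr 1
  exact Finset.sum_congr rfl fun k _ => Finset.sum_congr rfl fun l _ => by ring

/-- Sample second moments of the factor, centered. -/
def factorError [MeasurableSpace Ω] (m : Model Ω d r 𝒮) (μ : Measure Ω) (N : ℕ) (ω : Ω) :
    Matrix (Fin d × Fin r) (Fin d × Fin r) ℝ :=
  Matrix.of fun k l => (m.T N : ℝ)⁻¹ * ∑ t ∈ Finset.Icc 1 (m.T N),
    (m.X t ω k.1 k.2 * m.X t ω l.1 l.2 - m.factorCov μ k l)

/-- Sample cross moments of the factor and the noise on a set of sites. -/
def factorNoise (m : Model Ω d r 𝒮) (S : Finset 𝒮) (N : ℕ) (ω : Ω) :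
    Matrix (Fin d × Fin r) (S × Fin (m.p N)) ℝ :=
  Matrix.of fun k y => (m.T N : ℝ)⁻¹ * ∑ t ∈ Finset.Icc 1 (m.T N),
    m.X t ω k.1 k.2 * m.ε N t ω y.1 y.2

/-- Sample cross moments of the noise. -/
def noiseNoise (m : Model Ω d r 𝒮) (N : ℕ) (ω : Ω) :
    Matrix (m.S₁ N × Fin (m.p N)) (m.S₂ N × Fin (m.p N)) ℝ :=
  Matrix.of fun x y => (m.T N : ℝ)⁻¹ * ∑ t ∈ Finset.Icc 1 (m.T N),
    m.ε N t ω x.1 x.2 * m.ε N t ω y.1 y.2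

/-- Expanding the product of two sums of signal and noise gives four averages, and the population
term is absorbed by centering the factor-factor one. Positivity of `T` lets the constant `Σ` be
written as its own time average. -/
theorem sampleCross_sub_popCross [MeasurableSpace Ω] (μ : Measure Ω) {N : ℕ} (hT : 0 < m.T N)
    (ω : Ω) :
    m.sampleCross N ω - m.popCross μ N =
      ((m.A₁ N ⊗ₖ m.B N) * (m.factorError μ N ω * (m.A₂ N ⊗ₖ m.B N)ᵀ) +
        (m.A₁ N ⊗ₖ m.B N) * m.factorNoise (m.S₂ N) N ω) +
      ((m.factorNoise (m.S₁ N) N ω)ᵀ * (m.A₂ N ⊗ₖ m.B N)ᵀ + m.noiseNoise N ω) := by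
  have hT' : (m.T N : ℝ) ≠ 0 := by positivity
  have hC : ∀ k l, m.factorCov μ k l =
      (m.T N : ℝ)⁻¹ * ∑ t ∈ Finset.Icc 1 (m.T N), m.factorCov μ k l := fun k l => by
    simp [hT']
  rw [sub_eq_iff_eq_add]
  have hsum : m.factorError μ N ω + m.factorCov μ = Matrix.of fun k l =>
      (m.T N : ℝ)⁻¹ * ∑ t ∈ Finset.Icc 1 (m.T N), m.X t ω k.1 k.2 * m.X t ω l.1 l.2 := by
    ext k l
    rw [Matrix.add_apply, hC k l]
    simp only [factorError, Matrix.of_apply]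
    rw [← mul_add, ← Finset.sum_add_distrib]
    simp
  have hre : ∀ P Q R S P' : Matrix (m.S₁ N × Fin (m.p N)) (m.S₂ N × Fin (m.p N)) ℝ,
      P + Q + (R + S) + P' = (P + P') + Q + R + S := fun P Q R S P' => by abel
  rw [popCross, hre, ← Matrix.mul_add, ← Matrix.add_mul, hsum]
  ext ⟨u, i⟩ ⟨v, j⟩
  simp only [sampleCross, sampleOmega, Matrix.of_apply, Matrix.smul_apply, Matrix.sum_apply,
    Matrix.vecMulVec_apply, y_apply, Matrix.add_apply, Matrix.mul_apply, Matrix.transpose_apply,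
    Matrix.kroneckerMap_apply, factorNoise, noiseNoise, A₁, A₂, smul_eq_mul]
  have e1 : ∀ (c : ℝ) (g : ℕ → ℝ) (h : ℝ),
      (c * ∑ t ∈ Finset.Icc 1 (m.T N), g t) * h = c * ∑ t ∈ Finset.Icc 1 (m.T N), g t * h :=
    fun c g h => by rw [mul_assoc, Finset.sum_mul]
  have e2 : ∀ (c : ℝ) (g : ℕ → ℝ) (h : ℝ),
      h * (c * ∑ t ∈ Finset.Icc 1 (m.T N), g t) = c * ∑ t ∈ Finset.Icc 1 (m.T N), h * g t :=
    fun c g h => by rw [mul_left_comm, Finset.mul_sum]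
  have e3 : ∀ (c : ℝ) (g : Fin d × Fin r → ℕ → ℝ),
      ∑ k, c * ∑ t ∈ Finset.Icc 1 (m.T N), g k t = c * ∑ t ∈ Finset.Icc 1 (m.T N), ∑ k, g k t :=
    fun c g => by rw [← Finset.mul_sum, Finset.sum_comm]
  simp only [e1, e2, e3]
  rw [← mul_add, ← mul_add, ← mul_add, ← Finset.sum_add_distrib, ← Finset.sum_add_distrib,
    ← Finset.sum_add_distrib]
  congr 1
  refine Finset.sum_congr rfl fun t _ => ?_
  rw [add_mul, mul_add, mul_add, Finset.sum_mul_sum, Finset.sum_mul, Finset.mul_sum, ← add_assoc]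
  congr 1
  congr 1
  · congr 1
    · refine Finset.sum_congr rfl fun k _ => ?_
      rw [Finset.mul_sum]
      exact Finset.sum_congr rfl fun l _ => by ring
    · exact Finset.sum_congr rfl fun k _ => by ring
  · exact Finset.sum_congr rfl fun k _ => by ring

theorem frobSq_sampleCross_sub_le [MeasurableSpace Ω] (μ : Measure Ω) {N : ℕ} (hT : 0 < m.T N)
    (ω : Ω) :
    frobSq (m.sampleCross N ω - m.popCross μ N) ≤
      4 * (frobSq (m.A₁ N ⊗ₖ m.B N) * frobSq (m.A₂ N ⊗ₖ m.B N) * frobSq (m.factorError μ N ω) +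
        frobSq (m.A₁ N ⊗ₖ m.B N) * frobSq (m.factorNoise (m.S₂ N) N ω) +
        frobSq (m.A₂ N ⊗ₖ m.B N) * frobSq (m.factorNoise (m.S₁ N) N ω) +
        frobSq (m.noiseNoise N ω)) := by
  rw [sampleCross_sub_popCross μ hT]
  set L₁ := m.A₁ N ⊗ₖ m.B N
  set L₂ := m.A₂ N ⊗ₖ m.B N
  set FE := m.factorError μ N ω
  set F₂ := m.factorNoise (m.S₂ N) N ω
  set F₁ := m.factorNoise (m.S₁ N) N ω
  set E := m.noiseNoise N ω
  have h1 := frobSq_add_le (L₁ * (FE * L₂ᵀ) + L₁ * F₂) (F₁ᵀ * L₂ᵀ + E)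
  have h2 := frobSq_add_le (L₁ * (FE * L₂ᵀ)) (L₁ * F₂)
  have h3 := frobSq_add_le (F₁ᵀ * L₂ᵀ) E
  have h4 : frobSq (L₁ * (FE * L₂ᵀ)) ≤ frobSq L₁ * frobSq L₂ * frobSq FE := by
    refine (frobSq_mul_le _ _).trans ?_
    have := frobSq_mul_le FE L₂ᵀ
    rw [frobSq_transpose] at this
    calc _ ≤ frobSq L₁ * (frobSq FE * frobSq L₂) :=
          mul_le_mul_of_nonneg_left this (frobSq_nonneg _)
      _ = _ := by ring
  have h5 := frobSq_mul_le L₁ F₂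
  have h6 := frobSq_mul_le F₁ᵀ L₂ᵀ
  rw [frobSq_transpose F₁, frobSq_transpose L₂] at h6
  linarith

variable [MeasurableSpace Ω] {μ : Measure Ω}

theorem integral_frobSq_le {ι κ : Type*} [Fintype ι] [Fintype κ] {R : Ω → Matrix ι κ ℝ} {c : ℝ}
    (hL : ∀ i j, MemLp (fun ω => R ω i j) 2 μ) (hc : ∀ i j, ∫ ω, R ω i j ^ 2 ∂μ ≤ c) :
    Integrable (fun ω => frobSq (R ω)) μ ∧
      ∫ ω, frobSq (R ω) ∂μ ≤ Fintype.card ι * Fintype.card κ * c := by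
  have hi : ∀ i j, Integrable (fun ω => R ω i j ^ 2) μ := fun i j => (hL i j).integrable_sq
  refine ⟨integrable_finsetSum _ fun i _ => integrable_finsetSum _ fun j _ => hi i j, ?_⟩
  simp only [frobSq]
  rw [integral_finsetSum _ fun i _ => integrable_finsetSum _ fun j _ => hi i j]
  calc _ ≤ ∑ _i : ι, ∑ _j : κ, c := Finset.sum_le_sum fun i _ => by
        rw [integral_finsetSum _ fun j _ => hi i j]
        exact Finset.sum_le_sum fun j _ => hc i j
    _ = _ := by simp [mul_assoc]

variable [IsProbabilityMeasure μ]

/-- Signal and noise are independent, and noises at distinct sites are uncorrelated. Disjointness of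
the two sets of sites is what removes the noise variance here. -/
theorem popOmega_apply (hmix : m.MixingCondition μ q) (hmom : m.MomentRankCondition μ q)
    (hnoise : m.NuggetNoise μ) (hdesign : m.Design) {N : ℕ} (i j : Fin (m.p N)) (u : m.S₁ N)
    (v : m.S₂ N) : m.popOmega μ N i j u v = m.popCross μ N (u, i) (v, j) := by
  obtain ⟨C, -, hfac, -⟩ := exists_factor_moments hmix hmom
  have huv : (u : 𝒮) ≠ v := fun h =>
    Finset.disjoint_left.1 (hdesign.disjoint N) u.2 (h ▸ v.2)
  let S : 𝒮 → Fin (m.p N) → Ω → ℝ := fun s i ω =>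
    ∑ k : Fin d × Fin r, (m.a s k.1 * m.B N i k.2) * m.X 0 ω k.1 k.2
  have hSL : ∀ s i, MemLp (S s i) 2 μ := fun s i =>
    memLp_finsetSum _ fun k _ => (hfac 0 k).1.const_mul _
  have heL := fun s i => hnoise.memLp N 0 s i
  have hind : ∀ s i s' i', IndepFun (S s i) (fun ω => m.ε N 0 ω s' i') μ := fun s i s' i' =>
    (hnoise.indep_factor N).comp
      (φ := fun x : ℤ → Fin d × Fin r → ℝ =>
        ∑ k : Fin d × Fin r, (m.a s k.1 * m.B N i k.2) * x 0 k)
      (ψ := fun x : ℤ → 𝒮 × Fin (m.p N) → ℝ => x 0 (s', i')) (by fun_prop) (by fun_prop)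
  have hy : ∀ s i, (fun ω => m.y N 0 ω s i) = S s i + fun ω => m.ε N 0 ω s i := fun s i => by
    ext ω; exact y_apply N 0 ω s i
  have hff : ∀ k l : Fin d × Fin r,
      cov[fun ω => m.X 0 ω k.1 k.2, fun ω => m.X 0 ω l.1 l.2; μ] = m.factorCov μ k l :=
    fun k l => by simp [covariance, hmix.mean_zero, factorCov]
  simp only [popOmega, Matrix.of_apply, hy]
  rw [covariance_add_left (hSL _ _) (heL _ _) ((hSL _ _).add (heL _ _)),
    covariance_add_right (hSL _ _) (hSL _ _) (heL _ _),
    covariance_add_right (heL _ _) (hSL _ _) (heL _ _),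
    (hind _ _ _ _).covariance_eq_zero (hSL _ _) (heL _ _),
    (hind _ _ _ _).symm.covariance_eq_zero (heL _ _) (hSL _ _),
    hnoise.uncorrelated N 0 u v huv i j]
  simp only [S]
  rw [covariance_fun_sum_fun_sum (fun k => (hfac 0 k).1.const_mul _)
    (fun k => (hfac 0 k).1.const_mul _)]
  simp only [covariance_const_mul_left, covariance_const_mul_right, hff, add_zero, popCross,
    Matrix.mul_apply, Matrix.kroneckerMap_apply, Matrix.transpose_apply, A₁, A₂, Matrix.of_apply]
  refine Finset.sum_congr rfl fun k _ => ?_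
  rw [Finset.mul_sum]
  exact Finset.sum_congr rfl fun l _ => by ring

theorem popM₁_eq (hmix : m.MixingCondition μ q) (hmom : m.MomentRankCondition μ q)
    (hnoise : m.NuggetNoise μ) (hdesign : m.Design) (N : ℕ) :
    m.popM₁ μ N = unfoldRows (m.popCross μ N) * (unfoldRows (m.popCross μ N))ᵀ := by
  rw [popM₁, sum_mul_transpose_eq_unfoldRows (m.popOmega μ N)]
  have : (Matrix.of fun (x : m.S₁ N × Fin (m.p N)) (y : m.S₂ N × Fin (m.p N)) =>
      m.popOmega μ N x.2 y.2 x.1 y.1) = m.popCross μ N := by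
    ext x y; exact popOmega_apply hmix hmom hnoise hdesign _ _ _ _
  rw [this]

/-- Identification makes the factor covariance nondegenerate in its row index. -/
theorem exists_factorCov_expandsBy (hmix : m.MixingCondition μ q)
    (hmom : m.MomentRankCondition μ q) (hnoise : m.NuggetNoise μ) (hdesign : m.Design)
    (hid : ∀ᶠ N in atTop, (m.popM₁ μ N).rank = d) :
    ∃ c, 0 < c ∧ ExpandsBy (unfoldRows (m.factorCov μ))ᵀ c := by
  -- One stage is enough: `Σ` is the same for all `N`, and so is the resulting constant.
  obtain ⟨N, hN⟩ := hid.exists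
  rw [popM₁_eq hmix hmom hnoise hdesign] at hN
  exact exists_expandsBy_of_injective _ (unfoldRows_transpose_injective_of_rank hN)

/-- Mean square errors of the four components of the sample cross-space covariance. -/
theorem exists_component_bounds (hmix : m.MixingCondition μ q) (hmom : m.MomentRankCondition μ q)
    (hnoise : m.NuggetNoise μ) (hdesign : m.Design) :
    ∃ K : ℝ, 0 ≤ K ∧ ∀ N, 0 < m.T N →
      (Integrable (fun ω => frobSq (m.factorError μ N ω)) μ ∧
        ∫ ω, frobSq (m.factorError μ N ω) ∂μ ≤ K / m.T N) ∧
      (Integrable (fun ω => frobSq (m.factorNoise (m.S₁ N) N ω)) μ ∧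
        ∫ ω, frobSq (m.factorNoise (m.S₁ N) N ω) ∂μ ≤ K * (m.n₁ N * m.p N) / m.T N) ∧
      (Integrable (fun ω => frobSq (m.factorNoise (m.S₂ N) N ω)) μ ∧
        ∫ ω, frobSq (m.factorNoise (m.S₂ N) N ω) ∂μ ≤ K * (m.n₂ N * m.p N) / m.T N) ∧
      (Integrable (fun ω => frobSq (m.noiseNoise N ω)) μ ∧
        ∫ ω, frobSq (m.noiseNoise N ω) ∂μ ≤
          K * (m.n₁ N * m.p N * (m.n₂ N * m.p N)) / m.T N) := by
  obtain ⟨C, -, -, hprod⟩ := exists_factor_moments hmix hmom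
  obtain ⟨K₁, hK₁, h₁⟩ := exists_factor_average_bound hmix hmom
  obtain ⟨K₂, hK₂, h₂⟩ := exists_factor_noise_average_bound hmix hmom hnoise
  obtain ⟨K₃, hK₃, h₃⟩ := exists_noise_average_bound hnoise hdesign
  set D : ℝ := d * r with hD
  have hD0 : 0 ≤ D := by positivity
  refine ⟨D * D * K₁ + D * K₂ + K₃, by positivity, fun N hT => ?_⟩
  have hT' : (0 : ℝ) < m.T N := by exact_mod_cast hT
  have havg : ∀ (Z : ℕ → Ω → ℝ), (∀ t, MemLp (Z t) 2 μ) →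
      MemLp (fun ω => (m.T N : ℝ)⁻¹ * ∑ t ∈ Finset.Icc 1 (m.T N), Z t ω) 2 μ := fun Z hZ =>
    (memLp_finsetSum (Finset.Icc 1 (m.T N)) fun t _ => hZ t).const_mul _
  refine ⟨?_, ?_, ?_, ?_⟩
  · have := integral_frobSq_le (μ := μ) (R := fun ω => m.factorError μ N ω) (c := K₁ / m.T N)
      (fun k l => havg _ fun t => (hprod t k l).1.sub (memLp_const _))
      (fun k l => h₁ k l _ hT)
    refine ⟨this.1, this.2.trans ?_⟩
    simp only [Fintype.card_prod, Fintype.card_fin, Nat.cast_mul, ← hD]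
    rw [← mul_div_assoc]
    gcongr
    have : 0 ≤ D * K₂ := by positivity
    linarith
  · have := integral_frobSq_le (μ := μ) (R := fun ω => m.factorNoise (m.S₁ N) N ω)
      (c := K₂ / m.T N)
      (fun k y => havg _ fun t => (h₂ N k y.1 (Or.inl y.1.2) y.2 _ hT).1 t)
      (fun k y => (h₂ N k y.1 (Or.inl y.1.2) y.2 _ hT).2)
    refine ⟨this.1, this.2.trans ?_⟩
    simp only [Fintype.card_prod, Fintype.card_fin, Fintype.card_coe, Nat.cast_mul, ← hD]
    change D * (m.n₁ N * m.p N) * _ ≤ _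
    rw [← mul_div_assoc, mul_right_comm]
    gcongr
    have : 0 ≤ D * D * K₁ := by positivity
    linarith
  · have := integral_frobSq_le (μ := μ) (R := fun ω => m.factorNoise (m.S₂ N) N ω)
      (c := K₂ / m.T N)
      (fun k y => havg _ fun t => (h₂ N k y.1 (Or.inr y.1.2) y.2 _ hT).1 t)
      (fun k y => (h₂ N k y.1 (Or.inr y.1.2) y.2 _ hT).2)
    refine ⟨this.1, this.2.trans ?_⟩
    simp only [Fintype.card_prod, Fintype.card_fin, Fintype.card_coe, Nat.cast_mul, ← hD]
    change D * (m.n₂ N * m.p N) * _ ≤ _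
    rw [← mul_div_assoc, mul_right_comm]
    gcongr
    have : 0 ≤ D * D * K₁ := by positivity
    linarith
  · have := integral_frobSq_le (μ := μ) (R := fun ω => m.noiseNoise N ω) (c := K₃ / m.T N)
      (fun x y => havg _ fun t => (h₃ N x.1 x.1.2 y.1 y.1.2 x.2 y.2 _ hT).1 t)
      (fun x y => (h₃ N x.1 x.1.2 y.1 y.1.2 x.2 y.2 _ hT).2)
    refine ⟨this.1, this.2.trans ?_⟩
    simp only [Fintype.card_prod, Fintype.card_fin, Fintype.card_coe, Nat.cast_mul]
    change (m.n₁ N : ℝ) * m.p N * (m.n₂ N * m.p N) * _ ≤ _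
    rw [← mul_div_assoc, mul_comm _ K₃]
    gcongr
    have : 0 ≤ D * D * K₁ := by positivity
    have : 0 ≤ D * K₂ := by positivity
    linarith

end Model

/-! ### Rates -/

/-- Markov's inequality for the dominating variable at level `(kρ)²`. The choice `k = K/η + 1`
ensures `K ≤ η k²` and `k > 0`. -/
theorem isBigOp_of_sq_le {Ω : Type*} [MeasurableSpace Ω] {μ : Measure Ω} [IsFiniteMeasure μ]
    {D : ℕ → Ω → ℝ} {ρ : ℕ → ℝ} {K : ℝ} (hK : 0 ≤ K)
    (h : ∀ᶠ N in atTop, 0 < ρ N ∧ ∃ R : Ω → ℝ, Integrable R μ ∧ (∀ ω, D N ω ^ 2 ≤ R ω) ∧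
      ∫ ω, R ω ∂μ ≤ K * ρ N ^ 2) : IsBigOp μ D ρ := by
  intro η hη
  set k := K / η + 1 with hk
  have hk1 : 1 ≤ k := by
    have : 0 ≤ K / η := by positivity
    linarith
  have hKk : K ≤ η * k ^ 2 := by
    have h1 : K = η * (k - 1) := by rw [hk]; field_simp; ring
    rw [h1]
    gcongr
    nlinarith
  refine ⟨k, by linarith, ?_⟩
  filter_upwards [h] with N hN
  obtain ⟨hρ, R, hR, hDR, hbound⟩ := hN
  have hR0 : 0 ≤ᵐ[μ] R := ae_of_all _ fun ω => (sq_nonneg _).trans (hDR ω)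
  have hmarkov := mul_meas_ge_le_integral_of_nonneg hR0 hR ((k * ρ N) ^ 2)
  have hpos : 0 < (k * ρ N) ^ 2 := by positivity
  have hle : μ.real {ω | (k * ρ N) ^ 2 ≤ R ω} ≤ η := by
    refine le_of_mul_le_mul_left (hmarkov.trans (hbound.trans ?_)) hpos
    calc K * ρ N ^ 2 ≤ η * k ^ 2 * ρ N ^ 2 := by gcongr
      _ = _ := by ring
  have hsub : {ω | k * ρ N < |D N ω|} ⊆ {ω | (k * ρ N) ^ 2 ≤ R ω} := fun ω hω => by
    have hω' : k * ρ N < |D N ω| := hω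
    have h2 : (k * ρ N) ^ 2 ≤ |D N ω| ^ 2 := by gcongr
    rw [sq_abs] at h2
    exact h2.trans (hDR ω)
  calc μ {ω | k * ρ N < |D N ω|} ≤ μ {ω | (k * ρ N) ^ 2 ≤ R ω} := measure_mono hsub
    _ = ENNReal.ofReal (μ.real {ω | (k * ρ N) ^ 2 ≤ R ω}) := by simp
    _ ≤ _ := ENNReal.ofReal_le_ofReal hle

namespace Model

open scoped Kronecker

variable {Ω : Type*} {d r : ℕ} {𝒮 : Set (EuclideanSpace ℝ (Fin 2))} {m : Model Ω d r 𝒮}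
  {q δ γ : ℝ}

/-- The mean square rate `n₁^δ n₂^δ p^{2γ} T⁻¹`. -/
def sqRate (m : Model Ω d r 𝒮) (δ γ : ℝ) (N : ℕ) : ℝ :=
  (m.n₁ N : ℝ) ^ δ * (m.n₂ N : ℝ) ^ δ * (m.p N : ℝ) ^ (2 * γ) * (m.T N : ℝ)⁻¹

theorem eventually_sizes (hd : 0 < d) (hdesign : m.Design) :
    ∀ᶠ N in atTop, (1 : ℝ) ≤ m.n₁ N ∧ (1 : ℝ) ≤ m.n₂ N ∧ (1 : ℝ) ≤ m.p N ∧ r ≤ m.p N ∧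
      0 < m.T N := by
  filter_upwards [hdesign.p_tendsto.eventually_ge_atTop 1, hdesign.p_tendsto.eventually_ge_atTop r,
    hdesign.T_tendsto.eventually_gt_atTop 0] with N h1 h2 h3
  have h4 := hdesign.d_le_n₁ N
  have h5 := hdesign.d_le_n₂ N
  refine ⟨?_, ?_, ?_, h2, h3⟩
  · exact_mod_cast (by omega : 1 ≤ m.n₁ N)
  · exact_mod_cast (by omega : 1 ≤ m.n₂ N)
  · exact_mod_cast h1

/-- The mean square rate is the third summand of the squared rate. Sizes are at least one since `n₁,
n₂ ≥ d ≥ 1`, which makes the rate positive. -/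
theorem sqRate_le_rate_sq (hd : 0 < d) (hdesign : m.Design) :
    ∀ᶠ N in atTop, 0 < m.rate δ γ N ∧ m.sqRate δ γ N ≤ m.rate δ γ N ^ 2 := by
  filter_upwards [eventually_sizes hd hdesign] with N ⟨hn₁, hn₂, hp, _, hT⟩
  have hT' : (0 : ℝ) < m.T N := by exact_mod_cast hT
  have hn₁0 : (0 : ℝ) < m.n₁ N := by linarith
  have hn₂0 : (0 : ℝ) < m.n₂ N := by linarith
  have hp0 : (0 : ℝ) < m.p N := by linarith
  refine ⟨Real.sqrt_pos.2 (by positivity), ?_⟩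
  rw [rate, Real.sq_sqrt (by positivity), sqRate]
  gcongr
  exact le_add_of_nonneg_left (by positivity)

theorem sqRate_le_balancedRate_sq (hd : 0 < d) (hdesign : m.Design)
    (hδ : δ ∈ Set.Icc (0 : ℝ) 1) :
    ∀ᶠ N in atTop, 0 < m.balancedRate δ γ N ∧ m.sqRate δ γ N ≤ m.balancedRate δ γ N ^ 2 := by
  filter_upwards [eventually_sizes hd hdesign] with N ⟨hn₁, hn₂, hp, _, hT⟩
  have hT' : (0 : ℝ) < m.T N := by exact_mod_cast hT
  have hp0 : (0 : ℝ) < m.p N := by linarith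
  have hn : (m.n N : ℝ) = m.n₁ N + m.n₂ N := by simp [n]
  have hn0 : (0 : ℝ) < m.n N := by linarith
  refine ⟨by unfold balancedRate; positivity, ?_⟩
  have h1 : (m.n₁ N : ℝ) ^ δ ≤ (m.n N : ℝ) ^ δ :=
    Real.rpow_le_rpow (by positivity) (by linarith) hδ.1
  have h2 : (m.n₂ N : ℝ) ^ δ ≤ (m.n N : ℝ) ^ δ :=
    Real.rpow_le_rpow (by positivity) (by linarith) hδ.1
  have h3 : (m.p N : ℝ) ^ (2 * γ) = ((m.p N : ℝ) ^ γ) ^ 2 := by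
    rw [mul_comm, Real.rpow_mul hp0.le, Real.rpow_two]
  have h4 : (m.T N : ℝ)⁻¹ = ((m.T N : ℝ) ^ (-(1 / 2) : ℝ)) ^ 2 := by
    rw [← Real.rpow_two, ← Real.rpow_mul hT'.le, ← Real.rpow_neg_one]
    norm_num
  rw [sqRate, balancedRate, h3, h4]
  calc _ ≤ (m.n N : ℝ) ^ δ * (m.n N : ℝ) ^ δ * ((m.p N : ℝ) ^ γ) ^ 2 *
        ((m.T N : ℝ) ^ (-(1 / 2) : ℝ)) ^ 2 := by gcongr
    _ = _ := by ring

/-! ### Exchanging the two sets of sites -/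

/-- The model with the two sets of sites exchanged. -/
def swap (m : Model Ω d r 𝒮) : Model Ω d r 𝒮 := { m with S₁ := m.S₂, S₂ := m.S₁ }

theorem Design.swap (h : m.Design) : m.swap.Design where
  disjoint N := (h.disjoint N).symm
  d_le_n₁ := h.d_le_n₂
  d_le_n₂ := h.d_le_n₁
  n_tendsto := h.n_tendsto.congr fun N => add_comm (m.n₁ N) (m.n₂ N)
  p_tendsto := h.p_tendsto
  T_tendsto := h.T_tendsto

theorem SpatialStrength.swap (h : m.SpatialStrength δ) : m.swap.SpatialStrength δ :=
  ⟨h.mem, h.min₂, h.max₂, h.min₁, h.max₁⟩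

theorem VariableStrength.swap (h : m.VariableStrength γ) : m.swap.VariableStrength γ :=
  ⟨h.mem, h.min, h.max⟩

/-- Exchanging the sets of sites transposes each block and interchanges its two variables; summation
over all pairs of variables absorbs the interchange. -/
theorem sum_mul_transpose_eq_of_swap {ι κ η : Type*} [Fintype ι] [Fintype κ] [Fintype η]
    {O : η → η → Matrix ι κ ℝ} {O' : η → η → Matrix κ ι ℝ} (h : ∀ i j, O' i j = (O j i)ᵀ) :
    ∑ i, ∑ j, O' i j * (O' i j)ᵀ = ∑ i, ∑ j, (O i j)ᵀ * O i j := by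
  rw [Finset.sum_comm]
  simp only [h, Matrix.transpose_transpose]

theorem sampleOmega_apply (N : ℕ) (ω : Ω) (i j : Fin (m.p N)) (u : m.S₁ N) (v : m.S₂ N) :
    m.sampleOmega N ω i j u v =
      (m.T N : ℝ)⁻¹ * ∑ t ∈ Finset.Icc 1 (m.T N), m.y N t ω u i * m.y N t ω v j := by
  simp only [sampleOmega, Matrix.smul_apply, Matrix.sum_apply, Matrix.vecMulVec_apply, smul_eq_mul]

theorem sampleM₁_swap (N : ℕ) (ω : Ω) : m.swap.sampleM₁ N ω = m.sampleM₂ N ω := by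
  refine sum_mul_transpose_eq_of_swap (O := m.sampleOmega N ω) fun i j => ?_
  ext u v
  refine (sampleOmega_apply (m := m.swap) N ω i j u v).trans
    (Eq.trans ?_ (sampleOmega_apply (m := m) N ω j i v u).symm)
  exact congrArg ((m.T N : ℝ)⁻¹ * ·)
    (Finset.sum_congr rfl fun t _ => mul_comm (m.y N t ω u i) (m.y N t ω v j))

theorem sqRate_swap (N : ℕ) : m.swap.sqRate δ γ N = m.sqRate δ γ N := by
  unfold sqRate
  rw [mul_comm ((m.n₁ N : ℝ) ^ δ)]
  rfl

variable [MeasurableSpace Ω] {μ : Measure Ω}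

theorem NuggetNoise.swap (h : m.NuggetNoise μ) : m.swap.NuggetNoise μ where
  measurable := h.measurable
  memLp := h.memLp
  mean_zero := h.mean_zero
  uncorrelated := h.uncorrelated
  indep_time := h.indep_time
  indep_factor := h.indep_factor
  bounded := by
    obtain ⟨K, h1, h2⟩ := h.bounded
    refine ⟨K, fun N t u hu i => h1 N t u hu.symm i, fun N t u hu v hv i j => ?_⟩
    have e : (fun ω => m.ε N t ω u i ^ 2 * m.ε N t ω v j ^ 2) =
        fun ω => m.ε N t ω v j ^ 2 * m.ε N t ω u i ^ 2 := funext fun ω => mul_comm _ _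
    change Integrable (fun ω => m.ε N t ω u i ^ 2 * m.ε N t ω v j ^ 2) μ ∧
      integral μ (fun ω => m.ε N t ω u i ^ 2 * m.ε N t ω v j ^ 2) ≤ K
    rw [e]
    exact h2 N t v hv u hu j i

theorem MixingCondition.swap (h : m.MixingCondition μ q) : m.swap.MixingCondition μ q :=
  ⟨h.measurable, h.mean_zero, h.stationary, h.two_lt, h.mixing⟩

theorem MomentRankCondition.swap (h : m.MomentRankCondition μ q) :
    m.swap.MomentRankCondition μ q :=
  ⟨h.moments, h.lagged⟩

theorem popM₁_swap (N : ℕ) : m.swap.popM₁ μ N = m.popM₂ μ N := by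
  refine sum_mul_transpose_eq_of_swap (O := m.popOmega μ N) fun i j => ?_
  ext u v
  exact covariance_comm _ _

/-! ### Consistency -/

variable [IsProbabilityMeasure μ]

/-- Mean square error of the sample cross-space covariance. -/
theorem exists_cross_error_bound (hmix : m.MixingCondition μ q) (hmom : m.MomentRankCondition μ q)
    (hnoise : m.NuggetNoise μ) (hdesign : m.Design) (hd : 0 < d) (hA : m.SpatialStrength δ)
    (hB : m.VariableStrength γ) :
    ∃ K : ℝ, 0 ≤ K ∧ ∀ᶠ N in atTop, ∃ R : Ω → ℝ, Integrable R μ ∧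
      (∀ ω, frobSq (m.sampleCross N ω - m.popCross μ N) ≤ R ω) ∧
      ∫ ω, R ω ∂μ ≤ K * (m.n₁ N * m.n₂ N * (m.p N : ℝ) ^ 2 / m.T N) := by
  obtain ⟨K, hK, hcomp⟩ := exists_component_bounds hmix hmom hnoise hdesign
  obtain ⟨a₁, ha₁, hA₁⟩ := hA.max₁.1.exists_pos
  obtain ⟨a₂, ha₂, hA₂⟩ := hA.max₂.1.exists_pos
  obtain ⟨b, hb, hBB⟩ := hB.max.1.exists_pos
  set H₁ := (d * a₁) * (r * b) with hH₁
  set H₂ := (d * a₂) * (r * b) with hH₂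
  refine ⟨4 * (H₁ * H₂ * K + H₁ * K + H₂ * K + K), by positivity, ?_⟩
  filter_upwards [eventually_sizes hd hdesign, hA₁.bound, hA₂.bound, hBB.bound]
    with N hsize h₁ h₂ hb'
  obtain ⟨hn₁, hn₂, hp, -, hT⟩ := hsize
  obtain ⟨⟨i1, c1⟩, ⟨i2, c2⟩, ⟨i3, c3⟩, ⟨i4, c4⟩⟩ := hcomp N hT
  set n₁ : ℝ := (m.n₁ N : ℝ)
  set n₂ : ℝ := (m.n₂ N : ℝ)
  set p : ℝ := (m.p N : ℝ)
  set T : ℝ := (m.T N : ℝ)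
  have hT' : 0 < T := by simpa [T] using hT
  -- The crude bound of `x^{1-e}` by `x` loses nothing in the end: the noise-noise term is already
  -- bounded by the order `n₁n₂p²/T`, and this brings the other three to the same order.
  have hpow : ∀ (x e : ℝ), 1 ≤ x → e ∈ Set.Icc (0 : ℝ) 1 → ‖x ^ (1 - e)‖ ≤ x := fun x e hx he => by
    rw [Real.norm_of_nonneg (by positivity)]
    calc x ^ (1 - e) ≤ x ^ (1 : ℝ) := Real.rpow_le_rpow_of_exponent_le hx (by linarith [he.1])
      _ = x := Real.rpow_one x
  have hspec : ∀ {ι κ : Type _} [Fintype ι] [Fintype κ] (A : Matrix ι κ ℝ) (c x e : ℝ), 0 < c →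
      1 ≤ x → e ∈ Set.Icc (0 : ℝ) 1 → ‖specNormSq A‖ ≤ c * ‖x ^ (1 - e)‖ →
      frobSq A ≤ Fintype.card κ * c * x := fun {ι κ} _ _ A c x e hc hx he h => by
    have h1 := frobSq_le_card_mul_specNormSq A
    have h2 : specNormSq A ≤ c * x := (le_abs_self _).trans
      (h.trans (mul_le_mul_of_nonneg_left (hpow x e hx he) hc.le))
    calc _ ≤ _ := h1
      _ ≤ Fintype.card κ * (c * x) := by gcongr
      _ = _ := by ring
  have hfB := hspec (m.B N) b p γ hb hp hB.mem hb'
  have hL : ∀ {ι : Type _} [Fintype ι] (A : Matrix ι (Fin d) ℝ) (c x : ℝ), 0 < c → 1 ≤ x →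
      ‖specNormSq A‖ ≤ c * ‖x ^ (1 - δ)‖ →
      frobSq (A ⊗ₖ m.B N) ≤ (d * c) * (r * b) * (x * p) := fun {ι} _ A c x hc hx h => by
    have h1 := hspec A c x δ hc hx hA.mem h
    rw [frobSq_kronecker]
    rw [Fintype.card_fin] at h1 hfB
    calc _ ≤ (d * c * x) * (r * b * p) :=
          mul_le_mul h1 hfB (frobSq_nonneg _) (by positivity)
      _ = _ := by ring
  have hL₁ : frobSq (m.A₁ N ⊗ₖ m.B N) ≤ H₁ * (n₁ * p) := hL _ a₁ n₁ ha₁ hn₁ h₁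
  have hL₂ : frobSq (m.A₂ N ⊗ₖ m.B N) ≤ H₂ * (n₂ * p) := hL _ a₂ n₂ ha₂ hn₂ h₂
  refine ⟨_, ?_, frobSq_sampleCross_sub_le μ hT, ?_⟩
  · exact ((((i1.const_mul _).add (i3.const_mul _)).add (i2.const_mul _)).add i4).const_mul 4
  set ℓ₁ := frobSq (m.A₁ N ⊗ₖ m.B N)
  set ℓ₂ := frobSq (m.A₂ N ⊗ₖ m.B N)
  have hℓ₁ : 0 ≤ ℓ₁ := frobSq_nonneg _
  have hℓ₂ : 0 ≤ ℓ₂ := frobSq_nonneg _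
  have j13 : Integrable (fun ω => ℓ₁ * ℓ₂ * frobSq (m.factorError μ N ω) +
      ℓ₁ * frobSq (m.factorNoise (m.S₂ N) N ω)) μ := (i1.const_mul _).add (i3.const_mul _)
  have j132 : Integrable (fun ω => ℓ₁ * ℓ₂ * frobSq (m.factorError μ N ω) +
      ℓ₁ * frobSq (m.factorNoise (m.S₂ N) N ω) + ℓ₂ * frobSq (m.factorNoise (m.S₁ N) N ω)) μ :=
    j13.add (i2.const_mul _)
  rw [integral_const_mul, integral_add j132 i4, integral_add j13 (i2.const_mul _),
    integral_add (i1.const_mul _) (i3.const_mul _), integral_const_mul, integral_const_mul,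
    integral_const_mul]
  calc _ ≤ 4 * (H₁ * (n₁ * p) * (H₂ * (n₂ * p)) * (K / T) +
        H₁ * (n₁ * p) * (K * (n₂ * p) / T) + H₂ * (n₂ * p) * (K * (n₁ * p) / T) +
        K * (n₁ * p * (n₂ * p)) / T) := by
        gcongr <;> exact integral_nonneg fun _ => frobSq_nonneg _
    _ = _ := by ring

/-- The squared distance of the column spaces is dominated by a variable of mean of the order of
the mean square rate. -/
theorem exists_spaceDist_bound (hd : 0 < d) (hdesign : m.Design) (hnoise : m.NuggetNoise μ)
    (hid : ∀ᶠ N in atTop, (m.popM₁ μ N).rank = d) (hmix : m.MixingCondition μ q)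
    (hmom : m.MomentRankCondition μ q) (hA : m.SpatialStrength δ) (hB : m.VariableStrength γ)
    (Ahat : (N : ℕ) → Ω → Matrix (m.S₁ N) (Fin d) ℝ)
    (hAhat : ∀ N ω, IsLeadingEigenvectors (m.sampleM₁ N ω) (Ahat N ω)) :
    ∃ K : ℝ, 0 ≤ K ∧ ∀ᶠ N in atTop, ∃ R : Ω → ℝ, Integrable R μ ∧
      (∀ ω, spaceDist (Ahat N ω) (m.A₁ N) ^ 2 ≤ R ω) ∧
      ∫ ω, R ω ∂μ ≤ K * m.sqRate δ γ N := by
  obtain ⟨K, hK, hcross⟩ := exists_cross_error_bound hmix hmom hnoise hdesign hd hA hB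
  obtain ⟨c, hc, hC⟩ := exists_factorCov_expandsBy hmix hmom hnoise hdesign hid
  obtain ⟨a₁, ha₁, hA₁⟩ := hA.min₁.2.exists_pos
  obtain ⟨a₂, ha₂, hA₂⟩ := hA.min₂.2.exists_pos
  obtain ⟨b, hb, hBB⟩ := hB.min.2.exists_pos
  refine ⟨4 * K * (a₁ * a₂ * b ^ 2 / c), by positivity, ?_⟩
  filter_upwards [eventually_sizes hd hdesign, hcross, hA₁.bound, hA₂.bound, hBB.bound]
    with N hsize hR h₁ h₂ hb'
  obtain ⟨hn₁, hn₂, hp, hrp, hT⟩ := hsize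
  obtain ⟨R, hRi, hRle, hRint⟩ := hR
  rw [Real.norm_of_nonneg (by positivity), Real.norm_of_nonneg (minNormSq_nonneg _)] at h₁ h₂ hb'
  have e₁ : ExpandsBy (m.A₁ N) (minNormSq (m.A₁ N)) :=
    minNormSq_mul_le _ (by rw [Fintype.card_fin, Fintype.card_coe]; exact hdesign.d_le_n₁ N)
  have e₂ : ExpandsBy (m.A₂ N) (minNormSq (m.A₂ N)) :=
    minNormSq_mul_le _ (by rw [Fintype.card_fin, Fintype.card_coe]; exact hdesign.d_le_n₂ N)
  -- `B` is tall once `p ≥ r`, so that `minNormSq` refers to `B'B`.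
  have eB : ExpandsBy (m.B N) (minNormSq (m.B N)) := minNormSq_mul_le _ (by simpa using hrp)
  set n₁ : ℝ := (m.n₁ N : ℝ) with hn₁def
  set n₂ : ℝ := (m.n₂ N : ℝ) with hn₂def
  set p : ℝ := (m.p N : ℝ) with hpdef
  set T : ℝ := (m.T N : ℝ) with hTdef
  have hT' : 0 < T := by simpa [T] using hT
  have hn₁0 : 0 < n₁ := by linarith
  have hn₂0 : 0 < n₂ := by linarith
  have hp0 : 0 < p := by linarith
  set x := n₁ ^ (1 - δ) with hx
  set y := n₂ ^ (1 - δ) with hy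
  set z := p ^ (1 - γ) with hz
  have hx0 : 0 < x := by positivity
  have hy0 : 0 < y := by positivity
  have hz0 : 0 < z := by positivity
  set α₁ := minNormSq (m.A₁ N)
  set α₂ := minNormSq (m.A₂ N)
  set β := minNormSq (m.B N)
  have hα₁ : 0 < α₁ := by
    by_contra h; push Not at h; nlinarith
  have hα₂ : 0 < α₂ := by
    by_contra h; push Not at h; nlinarith
  have hβ : 0 < β := by
    by_contra h; push Not at h; nlinarith
  -- The signal strength with `L = A₂ ⊗ B`: `B` enters twice, once through the row index of the
  -- cross-covariance and once through `L`.
  set s := β * (α₂ * β) * c * α₁ with hs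
  have hs0 : 0 < s := by positivity
  have hslow : c * (x * y * z ^ 2) ≤ (a₁ * a₂ * b ^ 2) * s := by
    calc c * (x * y * z ^ 2) ≤ c * ((a₁ * α₁) * (a₂ * α₂) * (b * β) ^ 2) := by gcongr
      _ = _ := by rw [hs]; ring
  refine ⟨fun ω => 4 / s * R ω, hRi.const_mul _, fun ω => ?_, ?_⟩
  · have hU := hAhat N ω
    rw [sampleM₁_eq] at hU
    have hdist := mul_spaceDist_sq_le hd (Ahat N ω) (m.A₁ N) (e₁.injective hα₁)
      (unfoldRows (m.popCross μ N)) _ _ (unfoldRows_kronecker_mul _ _ _) hU s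
      (signal_lower_bound e₁ eB hC (e₂.kronecker eB hα₂.le) hα₁ hβ.le hc.le (by positivity))
    have hsub : unfoldRows (m.sampleCross N ω) - unfoldRows (m.popCross μ N) =
      unfoldRows (m.sampleCross N ω - m.popCross μ N) := rfl
    rw [hsub, frobSq_unfoldRows] at hdist
    have := hRle ω
    change _ ≤ 4 / s * R ω
    rw [div_mul_eq_mul_div, le_div_iff₀ hs0]
    linarith
  · have hsplit : ∀ w e : ℝ, 0 < w → w = w ^ (1 - e) * w ^ e := fun w e hw => by
      rw [← Real.rpow_add hw]; simp
    -- Writing `w = w^{1-e} w^e` for each size separates the order of the signal from the error; the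
    -- rest is the mean square rate.
    have hnum : n₁ * n₂ * p ^ 2 / T = (x * y * z ^ 2) * m.sqRate δ γ N := by
      have h2γ : p ^ (2 * γ) = (p ^ γ) ^ 2 := by
        rw [mul_comm, Real.rpow_mul hp0.le, Real.rpow_two]
      rw [sqRate, ← hn₁def, ← hn₂def, ← hpdef, ← hTdef, h2γ]
      nth_rewrite 1 [hsplit n₁ δ hn₁0, hsplit n₂ δ hn₂0, hsplit p γ hp0]
      rw [← hx, ← hy, ← hz, div_eq_mul_inv]
      ring
    have hτ : 0 ≤ m.sqRate δ γ N := by unfold sqRate; positivity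
    rw [integral_const_mul]
    calc 4 / s * ∫ ω, R ω ∂μ ≤ 4 / s * (K * ((x * y * z ^ 2) * m.sqRate δ γ N)) := by
          rw [← hnum]; gcongr
      _ = 4 * K * m.sqRate δ γ N / c * (c * (x * y * z ^ 2)) / s := by field_simp
      _ ≤ 4 * K * m.sqRate δ γ N / c * ((a₁ * a₂ * b ^ 2) * s) / s := by gcongr
      _ = _ := by field_simp

theorem isBigOp_spaceDist (hd : 0 < d) (hdesign : m.Design) (hnoise : m.NuggetNoise μ)
    (hid : ∀ᶠ N in atTop, (m.popM₁ μ N).rank = d) (hmix : m.MixingCondition μ q)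
    (hmom : m.MomentRankCondition μ q) (hA : m.SpatialStrength δ) (hB : m.VariableStrength γ)
    (Ahat : (N : ℕ) → Ω → Matrix (m.S₁ N) (Fin d) ℝ)
    (hAhat : ∀ N ω, IsLeadingEigenvectors (m.sampleM₁ N ω) (Ahat N ω)) {ρ : ℕ → ℝ}
    (hρ : ∀ᶠ N in atTop, 0 < ρ N ∧ m.sqRate δ γ N ≤ ρ N ^ 2) :
    IsBigOp μ (fun N ω => spaceDist (Ahat N ω) (m.A₁ N)) ρ := by
  obtain ⟨K, hK, h⟩ := exists_spaceDist_bound hd hdesign hnoise hid hmix hmom hA hB Ahat hAhat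
  refine isBigOp_of_sq_le hK ?_
  filter_upwards [h, hρ] with N ⟨R, hR, hle, hbound⟩ hρN
  exact ⟨hρN.1, R, hR, hle, hbound.trans (mul_le_mul_of_nonneg_left hρN.2 hK)⟩

theorem isBigOp_spaceDist_swap (hd : 0 < d) (hdesign : m.Design) (hnoise : m.NuggetNoise μ)
    (hid : ∀ᶠ N in atTop, (m.popM₂ μ N).rank = d) (hmix : m.MixingCondition μ q)
    (hmom : m.MomentRankCondition μ q) (hA : m.SpatialStrength δ) (hB : m.VariableStrength γ)
    (Ahat : (N : ℕ) → Ω → Matrix (m.S₂ N) (Fin d) ℝ)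
    (hAhat : ∀ N ω, IsLeadingEigenvectors (m.sampleM₂ N ω) (Ahat N ω)) {ρ : ℕ → ℝ}
    (hρ : ∀ᶠ N in atTop, 0 < ρ N ∧ m.sqRate δ γ N ≤ ρ N ^ 2) :
    IsBigOp μ (fun N ω => spaceDist (Ahat N ω) (m.A₂ N)) ρ := by
  refine isBigOp_spaceDist (m := m.swap) hd hdesign.swap hnoise.swap ?_ hmix.swap hmom.swap
    hA.swap hB.swap Ahat (fun N ω => ?_) ?_
  · filter_upwards [hid] with N hN
    exact (congrArg Matrix.rank (popM₁_swap N)).trans hN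
  · exact (sampleM₁_swap (m := m) N ω).symm ▸ hAhat N ω
  · simpa only [sqRate_swap] using hρ

end Model

end SpatialFactor

end

/-! ### Convergence rates for both sets of sites -/

theorem mainTheorem1 {Ω : Type*} [MeasurableSpace Ω] (μ : Measure Ω) [IsProbabilityMeasure μ]
    {d r : ℕ} (hd : 0 < d) (hr : 0 < r) {𝒮 : Set (EuclideanSpace ℝ (Fin 2))}
    (m : SpatialFactor.Model Ω d r 𝒮) (q δ γ : ℝ)
    (hdesign : m.Design) (hnoise : m.NuggetNoise μ) (hid : m.Identified μ)
    (hmix : m.MixingCondition μ q) (hmom : m.MomentRankCondition μ q)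
    (hA : m.SpatialStrength δ) (hB : m.VariableStrength γ)
    (hrate : Tendsto (m.balancedRate δ γ) atTop (𝓝 0))
    (Ahat₁ : (N : ℕ) → Ω → Matrix (m.S₁ N) (Fin d) ℝ)
    (Ahat₂ : (N : ℕ) → Ω → Matrix (m.S₂ N) (Fin d) ℝ)
    (hAhat₁ : ∀ N ω, SpatialFactor.IsLeadingEigenvectors (m.sampleM₁ N ω) (Ahat₁ N ω))
    (hAhat₂ : ∀ N ω, SpatialFactor.IsLeadingEigenvectors (m.sampleM₂ N ω) (Ahat₂ N ω)) :
    (SpatialFactor.IsBigOp μ (fun N ω => SpatialFactor.spaceDist (Ahat₁ N ω) (m.A₁ N))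
        (m.rate δ γ) ∧
      SpatialFactor.IsBigOp μ (fun N ω => SpatialFactor.spaceDist (Ahat₂ N ω) (m.A₂ N))
        (m.rate δ γ)) ∧
    ((fun N => (m.n₁ N : ℝ)) =Θ[atTop] (fun N => (m.n N : ℝ)) →
      (fun N => (m.n₂ N : ℝ)) =Θ[atTop] (fun N => (m.n N : ℝ)) →
      SpatialFactor.IsBigOp μ (fun N ω => SpatialFactor.spaceDist (Ahat₁ N ω) (m.A₁ N))
        (m.balancedRate δ γ) ∧
      SpatialFactor.IsBigOp μ (fun N ω => SpatialFactor.spaceDist (Ahat₂ N ω) (m.A₂ N))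
        (m.balancedRate δ γ)) := by
  have h₁ := hid.mono fun N h => h.1
  have h₂ := hid.mono fun N h => h.2
  have hrate' := SpatialFactor.Model.sqRate_le_rate_sq (m := m) (δ := δ) (γ := γ) hd hdesign
  have hbal := SpatialFactor.Model.sqRate_le_balancedRate_sq (m := m) (γ := γ) hd hdesign hA.mem
  exact ⟨⟨SpatialFactor.Model.isBigOp_spaceDist hd hdesign hnoise h₁ hmix hmom hA hB _ hAhat₁
        hrate',
      SpatialFactor.Model.isBigOp_spaceDist_swap hd hdesign hnoise h₂ hmix hmom hA hB _ hAhat₂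
        hrate'⟩,
    fun _ _ =>
      ⟨SpatialFactor.Model.isBigOp_spaceDist hd hdesign hnoise h₁ hmix hmom hA hB _ hAhat₁ hbal,
        SpatialFactor.Model.isBigOp_spaceDist_swap hd hdesign hnoise h₂ hmix hmom hA hB _ hAhat₂
          hbal⟩⟩
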